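/- **Setting.** Let $h>0$ be a random channel coefficient (squared modulus) with density $p$ on $(0,\infty)$ and $\mathbf E_h[\log(1+h)]<\infty$. Let $\sigma_N^2>0$ (noise power), $R>0$ (rate), $\mathcal P>0$ and $\mathcal J>0$ (average power bounds). For measurable power allocations $P,J:(0,\infty)\to[0,\infty)$ over a frame put $$C(P,J)=\mathbf E_h\Big[\log\Big(1+\frac{hP(h)}{\sigma_N^2+J(h)}\Big)\Big],$$ $$\mathscr P_M(j)=\sup_{\mathbf E_h[J]\le j}\ \inf_{P:\,C(P,J)\ge R}\mathbf E_h[P],\qquad \mathscr J_M(q)=\sup_{\mathbf E_h[P]\le q}\ \inf_{J:\,C(P,J)\le R}\mathbf E_h[J]\qquad(j,q\ge 0).$$ **Games.** In the *jamming game with average power constraints* the transmitter and the jammer independently pick random allocations $P$ and $J$, subject to $\mathbf E[P_M]\le\mathcal P$ and $\mathbf E[J_M]\le\mathcal J$, where $P_M=\mathbf E_h[P(h)]$ and $J_M=\mathbf E_h[J(h)]$ are the frame powers; the transmitter minimizes and the jammer maximizes the outage probability $\Pr(C(P,J)<R)$. In the *game between frames* the players independently pick the laws of nonnegative random frame powers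 $P_M,J_M$ with $\mathbf E[P_M]\le\mathcal P$ and $\mathbf E[J_M]\le\mathcal J$, and the outage probability is $1-\Pr\{P_M\ge\mathscr P_M(J_M)\}$. **Theorem.** $\mathscr P_M$ and $\mathscr J_M$ are finite on $[0,\infty)$. The game between frames has exactly one Nash equilibrium $(F_P,F_J)$. The jamming game has a Nash equilibrium, and in each of its Nash equilibria the frame powers $P_M,J_M$ have the distributions $F_P,F_J$. Here $F_P,F_J$ are the distributions on $[0,\infty)$ whose CDFs satisfy $$F_P(\mathscr P_M(y))=k_p\,\mathbb U([0,2v])(y)+(1-k_p)\Delta_0(y)\quad(y\ge0),\qquad F_P(x)=1-k_p\quad(0\le x<\mathscr P_M(0)),$$ $$F_J(\mathscr J_M(x))=k_j\,\mathbb U([0,\mathscr P_M(2v)])(x)+(1-k_j)\Delta_0(x)\quad(x\ge\mathscr P_M(0)),$$ where $\mathbb U([r,t])$ is the CDF of the uniform distribution on $[r,t]$ and $\Delta_0$ is the CDF of the unit mass at $0$. The parameters $k_p,k_j\in[0,1]$ and $v\in[\max\{\mathcal J,\mathscr J_M(\mathcal P)/2\},\infty)$ are determined as follows. 1. There is a unique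 $v_0\ge0$ with $\mathcal P\mathcal J=[\mathscr P_M(2v_0)-\mathcal P](2v_0-\mathcal J)$. 2. Let $S(v_0)=\int_0^{2v_0}\mathscr P_M(y)\,dy-2v_0\mathcal P$. 3. If $S(v_0)<0$, then $v$ is the unique positive solution of $\int_0^{2v}\mathscr P_M(y)\,dy-2v\mathcal P=0$, $k_p=1$ and $k_j=\dfrac{\mathcal J\,\mathscr P_M(2v)}{2v[\mathscr P_M(2v)-\mathcal P]}$. 4. If $S(v_0)=0$, then $v=v_0$ and $k_p=k_j=1$. 5. If $S(v_0)>0$, then $v$ is the unique positive solution of $\int_0^{2v}\mathscr P_M(y)\,dy-\mathscr P_M(2v)(2v-\mathcal J)=0$, $k_p=\dfrac{2v\mathcal P}{\mathscr P_M(2v)[2v-\mathcal J]}$ and $k_j=1$. -/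

import Mathlib

open Set MeasureTheory
open scoped NNReal ENNReal

/-- The law of the (squared modulus of the) channel coefficient `h > 0` with density `p`. -/
noncomputable def channelLaw (p : ℝ → ℝ) : Measure ℝ :=
  (volume.restrict (Ioi 0)).withDensity (fun h => ENNReal.ofReal (p h))

/-- The frame power `E_h[P(h)]`, as an extended nonnegative number. -/
noncomputable def meanPower (m : Measure ℝ) (P : ℝ → ℝ≥0) : ℝ≥0∞ :=
  ∫⁻ h, (P h : ℝ≥0∞) ∂m

/-- The ergodic capacity `C(P, J) = E_h[log (1 + h P(h) / (N + J(h)))]`, with `N` the noise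
power; the integrand is nonnegative, so the expectation always makes sense in `[0, ∞]`. -/
noncomputable def capacity (m : Measure ℝ) (N : ℝ) (P J : ℝ → ℝ≥0) : ℝ≥0∞ :=
  ∫⁻ h, ENNReal.ofReal (Real.log (1 + h * (P h : ℝ) / (N + (J h : ℝ)))) ∂m

/-- Problem 1 (the jammer plays first): the largest, over jamming allocations of mean power at
most `j`, of the least transmitter power that supports the rate `R` against that allocation. -/
noncomputable def requiredTx (m : Measure ℝ) (N R : ℝ) (j : ℝ≥0∞) : ℝ≥0∞ :=
  ⨆ J ∈ {J : ℝ → ℝ≥0 | Measurable J ∧ meanPower m J ≤ j},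
    ⨅ P ∈ {P : ℝ → ℝ≥0 | Measurable P ∧ ENNReal.ofReal R ≤ capacity m N P J},
      meanPower m P

/-- Problem 2 (the transmitter plays first): the largest, over transmitter allocations of mean
power at most `q`, of the least jamming power that brings the capacity down to `R`. -/
noncomputable def requiredJx (m : Measure ℝ) (N R : ℝ) (q : ℝ≥0∞) : ℝ≥0∞ :=
  ⨆ P ∈ {P : ℝ → ℝ≥0 | Measurable P ∧ meanPower m P ≤ q},
    ⨅ J ∈ {J : ℝ → ℝ≥0 | Measurable J ∧ capacity m N P J ≤ ENNReal.ofReal R},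
      meanPower m J

/-- The curve `requiredTx` as a real function of a nonnegative real jamming power. -/
noncomputable def txCurve (m : Measure ℝ) (N R : ℝ) (y : ℝ) : ℝ :=
  (requiredTx m N R (ENNReal.ofReal y)).toReal

/-- The curve `requiredJx` as a real function of a nonnegative real transmitter power. -/
noncomputable def jxCurve (m : Measure ℝ) (N R : ℝ) (x : ℝ) : ℝ :=
  (requiredJx m N R (ENNReal.ofReal x)).toReal

/-- Nash equilibrium of a two-person zero-sum game in which the first player, with strategy set
`A`, minimizes the payoff `u`, and the second, with strategy set `B`, maximizes it. -/
def IsNashEquilibrium {α β : Type*} (A : Set α) (B : Set β) (u : α → β → ℝ≥0∞)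
    (a : α) (b : β) : Prop :=
  a ∈ A ∧ b ∈ B ∧ (∀ a' ∈ A, u a b ≤ u a' b) ∧ (∀ b' ∈ B, u a b' ≤ u a b)

/-- A mixed strategy in the jamming game: a power allocation over the frame, picked at random
(the randomness `Ω` is private to the player). -/
structure MixedAllocation where
  Ω : Type
  [measurableSpace : MeasurableSpace Ω]
  law : Measure Ω
  [isProbabilityMeasure : IsProbabilityMeasure law]
  power : Ω → ℝ → ℝ≥0
  measurable_power : Measurable (fun z : Ω × ℝ => power z.1 z.2)

attribute [instance] MixedAllocation.measurableSpace MixedAllocation.isProbabilityMeasure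

/-- Mixed strategies that obey the average power constraint `E[P_M] ≤ a`. -/
def averagePower (m : Measure ℝ) (a : ℝ) : Set MixedAllocation :=
  {S | ∫⁻ ω, meanPower m (S.power ω) ∂S.law ≤ ENNReal.ofReal a}

/-- The outage probability `Pr(C(P, J) < R)` when the two players randomize independently. -/
noncomputable def outage (m : Measure ℝ) (N R : ℝ) (S T : MixedAllocation) : ℝ≥0∞ :=
  (S.law.prod T.law) {z | capacity m N (S.power z.1) (T.power z.2) < ENNReal.ofReal R}

/-- The distribution of the frame power under a mixed strategy (under an average power
constraint the frame power is almost surely finite). -/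
noncomputable def frameLaw (m : Measure ℝ) (S : MixedAllocation) : Measure ℝ≥0 :=
  S.law.map (fun ω => (meanPower m (S.power ω)).toNNReal)

/-- Distributions of a nonnegative random frame power with mean at most `a`. -/
def averageLaws (a : ℝ) : Set (Measure ℝ≥0) :=
  {μ | IsProbabilityMeasure μ ∧ ∫⁻ x, (x : ℝ≥0∞) ∂μ ≤ ENNReal.ofReal a}

/-- The outage probability `1 - Pr{P_M ≥ 𝒫_M(J_M)}` of the game between frames, for independent
frame powers `P_M ∼ μ` and `J_M ∼ ν`. -/
noncomputable def frameOutage (m : Measure ℝ) (N R : ℝ) (μ ν : Measure ℝ≥0) : ℝ≥0∞ :=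
  1 - (μ.prod ν) {z : ℝ≥0 × ℝ≥0 | requiredTx m N R (z.2 : ℝ≥0∞) ≤ (z.1 : ℝ≥0∞)}

/-- The cumulative distribution function of a law on `[0, ∞)`. -/
noncomputable def cdfOn (μ : Measure ℝ≥0) (x : ℝ) : ℝ :=
  μ.real {t : ℝ≥0 | (t : ℝ) ≤ x}

/-- The CDF of the uniform distribution on `[r, t]`, `r < t`. -/
noncomputable def uniformCDF (r t x : ℝ) : ℝ :=
  max 0 (min 1 ((x - r) / (t - r)))

/-- The CDF of the Dirac distribution at `0`. -/
noncomputable def diracCDF (x : ℝ) : ℝ :=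
  if 0 ≤ x then 1 else 0

/-- `x` is the unique element of `D` that satisfies `E`. -/
def IsUniqueSolution (D : Set ℝ) (E : ℝ → Prop) (x : ℝ) : Prop :=
  x ∈ D ∧ E x ∧ ∀ w ∈ D, E w → w = x

/-- `S(v) = ∫₀^{2v} g(y) dy - 2 v a`. -/
noncomputable def sFun (g : ℝ → ℝ) (a v : ℝ) : ℝ :=
  (∫ y in (0 : ℝ)..(2 * v), g y) - 2 * v * a

/-- The case procedure that determines `v₀`, `v`, `k_p` and `k_j`. -/
def CaseProcedure (g : ℝ → ℝ) (a b v₀ v kp kj : ℝ) : Prop :=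
  IsUniqueSolution (Ici 0) (fun w => a * b = (g (2 * w) - a) * (2 * w - b)) v₀ ∧
  (sFun g a v₀ < 0 →
    IsUniqueSolution (Ioi 0) (fun w => (∫ y in (0 : ℝ)..(2 * w), g y) - 2 * w * a = 0) v ∧
    kp = 1 ∧ kj = b * g (2 * v) / (2 * v * (g (2 * v) - a))) ∧
  (sFun g a v₀ = 0 → v = v₀ ∧ kp = 1 ∧ kj = 1) ∧
  (0 < sFun g a v₀ →
    IsUniqueSolution (Ioi 0)
      (fun w => (∫ y in (0 : ℝ)..(2 * w), g y) - g (2 * w) * (2 * w - b) = 0) v ∧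
    kp = 2 * v * a / (g (2 * v) * (2 * v - b)) ∧ kj = 1)

/-- `μ` is the transmitter's law `F_P`: `F_P(𝒫_M(y)) = k_p U([0,2v])(y) + (1 - k_p) Δ₀(y)`, and
all mass below `𝒫_M(0)`, the least power of any use, sits at `0`. -/
def IsTxLaw (g : ℝ → ℝ) (kp v : ℝ) (μ : Measure ℝ≥0) : Prop :=
  (∀ y, 0 ≤ y → cdfOn μ (g y) = kp * uniformCDF 0 (2 * v) y + (1 - kp) * diracCDF y) ∧
  (∀ x, 0 ≤ x → x < g 0 → cdfOn μ x = 1 - kp)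

/-- `ν` is the jammer's law `F_J`: `F_J(𝒥_M(x)) = k_j U([0,𝒫_M(2v)])(x) + (1 - k_j) Δ₀(x)`, for
`x ≥ 𝒫_M(0)`; the curve `𝒥_M` vanishes for smaller `x` and is onto `[0, ∞)` from there on. -/
def IsJxLaw (g ginv : ℝ → ℝ) (kj v : ℝ) (ν : Measure ℝ≥0) : Prop :=
  ∀ x, g 0 ≤ x →
    cdfOn ν (ginv x) = kj * uniformCDF 0 (g (2 * v)) x + (1 - kj) * diracCDF x

/-!
In terms of the signal-to-noise ratio `Z = P / (N + J)` the rate is `E log (1 + h Z)`, and the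
transmitter spends `E[(N + J) Z]`, which is bilinear. So the game within a frame has a saddle
point: the transmitter water-fills up to a cap `Z ≤ c`, and the jammer raises the noise exactly
where the cap is active (`log_rate_add_le`, `log_snrFactor_add_le`). The saddle points that support
the rate `R` form a curve along which the jamming power takes every value `y ≥ 0`, while the water
level and the cap vary monotonically; hence they can be chosen measurably in `y`
(`exists_saddle_curve`, `nonempty_saddleFamily`). Consequently `requiredTx` has the caps as
supergradients: it is strictly increasing, Lipschitz, unbounded and lies above its chords from the
origin, and `requiredJx` is its inverse.

Write `g` for `requiredTx`, `a`, `b` for the power budgets. In the game between frames there is an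
outage iff `P_M < g J_M`. Against `F_P` the outage probability is affine in `J_M` on `[0, 2v]` and
below that line elsewhere; against `F_J` the probability of avoiding outage is affine in `P_M` on
`[g 0, g (2v)]` and below that line elsewhere. The case procedure chooses the parameters so that
both budgets are spent and the two lines give the same value (`exists_parameters`), so the two laws
form an equilibrium. For uniqueness, an optimal law of the transmitter makes the outage probability,
as a function of the jamming power, lie below a line through `b` (`exists_supporting_line`), with
equality wherever `F_J` has mass, that is on `[0, 2v]`; conversely `F_J` forbids the transmitter to
use powers in `(0, g 0)` or beyond `g (2v)`, which fixes the slope. The argument for the jammer is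
symmetric (`eq_txLaw_of_optimal`, `eq_jamLaw_of_optimal`).

Playing saddle-point allocations turns a law of the frame power into a mixed strategy of the jamming
game that guarantees at least what the law guarantees between frames (`outage_txStrategy_le`,
`le_outage_jamStrategy`). So the two games have the same value, and the frame powers of optimal
strategies follow optimal laws.
-/

namespace JammingGame

/-! ### The pointwise saddle point -/

/-- The factor `1 + h Z`, where `Z = P / (N + J)` is the signal-to-noise ratio at the saddle point:
water-filling at level `r * c`, capped at `Z = c`. -/
noncomputable def snrFactor (r c h : ℝ) : ℝ := min (1 + c * h) (max 1 (r * c * h))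

/-- The factor `(N + J) / N` by which the saddle-point jammer raises the noise: it jams exactly
where the cap on the signal-to-noise ratio is active. -/
noncomputable def noiseFactor (r c h : ℝ) : ℝ := max 1 (r * (c * h / (1 + c * h)))

section Pointwise

variable {N r c h : ℝ}

lemma one_le_snrFactor (hc : 0 ≤ c) (hh : 0 ≤ h) : 1 ≤ snrFactor r c h :=
  le_min (by nlinarith [mul_nonneg hc hh]) (le_max_left _ _)

lemma snrFactor_le : snrFactor r c h ≤ 1 + c * h := min_le_left _ _

lemma one_le_noiseFactor : 1 ≤ noiseFactor r c h := le_max_left _ _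

/-- The total received power `N + J + h P`, in units of the noise power `N`, follows uncapped
water-filling. -/
lemma noiseFactor_mul_snrFactor (hc : 0 < c) (hh : 0 < h) :
    noiseFactor r c h * snrFactor r c h = max 1 (r * c * h) := by
  have hch : 0 < c * h := mul_pos hc hh
  have e : r * (c * h / (1 + c * h)) = r * c * h / (1 + c * h) := by ring
  unfold noiseFactor snrFactor
  rw [e]
  rcases le_total (1 + c * h) (r * c * h) with h1 | h1
  · rw [max_eq_right ((one_le_div (by positivity)).2 h1), max_eq_right (by linarith),
      min_eq_left h1]
    field_simp
  · rw [max_eq_left ((div_le_one (by positivity)).2 h1), one_mul,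
      min_eq_right (max_le (by linarith) h1)]

lemma snrFactor_eq_of_one_lt (hc : 0 < c) (hh : 0 < h) (hK : 1 < noiseFactor r c h) :
    snrFactor r c h = 1 + c * h ∧ 1 + c * h < r * c * h := by
  have hch : 0 < c * h := mul_pos hc hh
  have e : r * (c * h / (1 + c * h)) = r * c * h / (1 + c * h) := by ring
  have h1 : 1 < r * c * h / (1 + c * h) := by
    rw [← e]
    rcases lt_max_iff.1 hK with h' | h'
    · exact absurd h' (lt_irrefl _)
    · exact h'
  rw [one_lt_div (by positivity)] at h1
  exact ⟨min_eq_left (h1.le.trans (le_max_right _ _)), h1⟩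

/-- Against the saddle-point jammer, the saddle-point allocation maximizes the rate minus the power
priced at `1 / (N r c)`, at every value of the channel coefficient. -/
lemma log_rate_add_le (hN : 0 < N) (hr : 1 ≤ r) (hc : 0 < c) (hh : 0 < h) {q : ℝ} (hq : 0 ≤ q) :
    Real.log (1 + h * q / (N * noiseFactor r c h))
        + N * noiseFactor r c h * ((snrFactor r c h - 1) / h) / (N * r * c)
      ≤ Real.log (snrFactor r c h) + q / (N * r * c) := by
  have hW := one_le_snrFactor (r := r) hc.le hh.le
  have hK := one_le_noiseFactor (r := r) (c := c) (h := h)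
  have hKW := noiseFactor_mul_snrFactor (r := r) hc hh
  set W := snrFactor r c h
  set K := noiseFactor r c h
  have hW0 : 0 < W := by linarith
  have hK0 : 0 < K := by linarith
  have hr0 : 0 < r := by linarith
  have hx : 0 < 1 + h * q / (N * K) := by positivity
  have h1 : Real.log (1 + h * q / (N * K)) - Real.log W ≤ (1 + h * q / (N * K)) / W - 1 := by
    rw [← Real.log_div hx.ne' hW0.ne']
    exact Real.log_le_sub_one_of_pos (by positivity)
  have h2 : (1 + h * q / (N * K)) / W - 1
      = (h * q - N * K * (W - 1)) / (N * (K * W)) := by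
    field_simp
    ring
  -- since `K * W = max 1 (r c h)`, the slope is `1 / (N r c)` wherever the transmitter is active
  have h3 : (h * q - N * K * (W - 1)) / (N * (K * W))
      ≤ q / (N * r * c) - N * K * ((W - 1) / h) / (N * r * c) := by
    rw [hKW]
    rcases le_total 1 (r * c * h) with h4 | h4
    · rw [max_eq_right h4]
      apply le_of_eq
      field_simp
    · have hKW1 : K * W = 1 := by rw [hKW, max_eq_left h4]
      have hW1 : W = 1 := by nlinarith
      rw [max_eq_left h4, hW1]
      simp only [sub_self, mul_zero, sub_zero, zero_div, mul_one]
      rw [div_le_div_iff₀ hN (by positivity)]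
      nlinarith [mul_nonneg hq (sub_nonneg.2 h4)]
  linarith

/-- Against the saddle-point transmitter, the saddle-point jammer minimizes the rate plus the
jamming power priced at `1 / (N r)`, at every value of the channel coefficient. -/
lemma log_snrFactor_add_le (hN : 0 < N) (hr : 1 ≤ r) (hc : 0 < c) (hh : 0 < h) {q : ℝ}
    (hq : 0 ≤ q) :
    Real.log (snrFactor r c h) + N * (noiseFactor r c h - 1) / (N * r)
      ≤ Real.log (1 + h * (N * noiseFactor r c h * ((snrFactor r c h - 1) / h)) / (N + q))
        + q / (N * r) := by
  have hW := one_le_snrFactor (r := r) hc.le hh.le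
  have hWc := snrFactor_le (r := r) (c := c) (h := h)
  have hK := one_le_noiseFactor (r := r) (c := c) (h := h)
  have hKW := noiseFactor_mul_snrFactor (r := r) hc hh
  have hK1 := snrFactor_eq_of_one_lt (r := r) hc hh
  set W := snrFactor r c h
  set K := noiseFactor r c h
  have hW0 : 0 < W := by linarith
  have hK0 : 0 < K := by linarith
  have hr0 : 0 < r := by linarith
  have hNq : 0 < N + q := by linarith
  -- the tangent inequality for the convex function `u ↦ log (1 + s / u)` at `u = 1`
  obtain ⟨s, hs⟩ : ∃ s, s = W - 1 := ⟨_, rfl⟩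
  obtain ⟨u, hu⟩ : ∃ u, u = (N + q) / (N * K) := ⟨_, rfl⟩
  have hs0 : 0 ≤ s := by linarith
  have hu0 : 0 < u := by rw [hu]; positivity
  have hWs : W = 1 + s := by linarith
  have e1 : 1 + h * (N * K * ((W - 1) / h)) / (N + q) = 1 + s / u := by
    rw [hu, ← hs]
    field_simp
  have h1 : Real.log W - Real.log (1 + s / u) ≤ (1 + s) / (1 + s / u) - 1 := by
    rw [hWs, ← Real.log_div (by positivity) (by positivity)]
    exact Real.log_le_sub_one_of_pos (by positivity)
  have h2 : (1 + s) / (1 + s / u) - 1 ≤ (u - 1) * s / (1 + s) := by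
    have : (1 + s) / (1 + s / u) - 1 = s * (u - 1) / (u + s) := by
      field_simp
      ring
    rw [this, div_le_div_iff₀ (by positivity) (by positivity)]
    nlinarith [mul_nonneg hs0 (sq_nonneg (u - 1))]
  have h3 : (u - 1) * s / (1 + s) = (q - N * (K - 1)) * (W - 1) / (N * (K * W)) := by
    rw [hu, ← hWs, ← hs]
    field_simp
    ring
  have h4 : (q - N * (K - 1)) * (W - 1) / (N * (K * W))
      ≤ q / (N * r) - N * (K - 1) / (N * r) := by
    rw [← sub_div, hKW]
    rcases eq_or_lt_of_le hK with h5 | h5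
    · rw [← h5]
      have hWm : W = max 1 (r * c * h) := by rw [← hKW, ← h5, one_mul]
      simp only [sub_self, mul_zero, sub_zero]
      rw [div_le_div_iff₀ (by positivity) (by positivity), ← hWm]
      rcases le_total 1 (r * c * h) with h4 | h4
      · rw [max_eq_right h4] at hWm
        have : (W - 1) * r ≤ W := by
          have : (W - 1) * r ≤ c * h * r := by
            apply mul_le_mul_of_nonneg_right _ hr0.le
            linarith
          linarith [hWm]
        nlinarith [mul_le_mul_of_nonneg_left this (mul_nonneg hq hN.le)]
      · rw [max_eq_left h4] at hWm
        rw [hWm]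
        simp only [sub_self, mul_zero, zero_mul]
        positivity
    · obtain ⟨h6, h7⟩ := hK1 h5
      rw [max_eq_right (by nlinarith [mul_pos hc hh]), h6]
      apply le_of_eq
      field_simp
      ring
  rw [e1]
  linarith

end Pointwise

/-! ### The curve of saddle-point parameters -/

section Curve

variable {m : Measure ℝ} [IsProbabilityMeasure m] {R : ℝ}

@[fun_prop]
lemma measurable_snrFactor {α : Type*} [MeasurableSpace α] {r c h : α → ℝ} (hr : Measurable r)
    (hc : Measurable c) (hh : Measurable h) : Measurable fun x => snrFactor (r x) (c x) (h x) := by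
  unfold snrFactor
  fun_prop

@[fun_prop]
lemma measurable_noiseFactor {α : Type*} [MeasurableSpace α] {r c h : α → ℝ} (hr : Measurable r)
    (hc : Measurable c) (hh : Measurable h) :
    Measurable fun x => noiseFactor (r x) (c x) (h x) := by
  unfold noiseFactor
  fun_prop

lemma log_le_of_le_one_add_mul {x c C h : ℝ} (hx1 : 1 ≤ x) (hx : x ≤ 1 + c * h) (hcC : c ≤ C)
    (hC : 0 ≤ C) (hh : 0 ≤ h) : Real.log x ≤ Real.log (1 + h) + Real.log (1 + C) := by
  rw [← Real.log_mul (by positivity) (by positivity)]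
  exact Real.log_le_log (by linarith) (by nlinarith [mul_le_mul_of_nonneg_right hcC hh])

lemma integrable_log_of_le_one_add_mul (hpos : ∀ᵐ h ∂m, 0 < h)
    (hlog : Integrable (fun h => Real.log (1 + h)) m) {F : ℝ → ℝ} (hF : Measurable F) {c : ℝ}
    (hc : 0 ≤ c) (hF1 : ∀ h, 0 < h → 1 ≤ F h ∧ F h ≤ 1 + c * h) :
    Integrable (fun h => Real.log (F h)) m := by
  refine Integrable.mono' (hlog.add (integrable_const (Real.log (1 + c))))
    (Real.measurable_log.comp hF).aestronglyMeasurable ?_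
  filter_upwards [hpos] with h hh
  rw [Real.norm_of_nonneg (Real.log_nonneg (hF1 h hh).1)]
  exact log_le_of_le_one_add_mul (hF1 h hh).1 (hF1 h hh).2 le_rfl hc hh.le

lemma continuousOn_integral_log (hpos : ∀ᵐ h ∂m, 0 < h)
    (hlog : Integrable (fun h => Real.log (1 + h)) m) {F : ℝ → ℝ → ℝ} (hF : ∀ c, Measurable (F c))
    {C : ℝ} (hF1 : ∀ c, 0 ≤ c → ∀ h, 0 < h → 1 ≤ F c h ∧ F c h ≤ 1 + c * h)
    (hFc : ∀ h, Continuous fun c => F c h) :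
    ContinuousOn (fun c => ∫ h, Real.log (F c h) ∂m) (Icc 0 C) := by
  rcases lt_or_ge C 0 with hC | hC
  · rw [Icc_eq_empty (by linarith)]
    exact continuousOn_empty _
  refine continuousOn_of_dominated (bound := fun h => Real.log (1 + h) + Real.log (1 + C))
    (fun c _ => (Real.measurable_log.comp (hF c)).aestronglyMeasurable) ?_
    (hlog.add (integrable_const _)) ?_
  · intro c hc
    filter_upwards [hpos] with h hh
    obtain ⟨h1, h2⟩ := hF1 c hc.1 h hh
    rw [Real.norm_of_nonneg (Real.log_nonneg h1)]
    exact log_le_of_le_one_add_mul h1 h2 hc.2 hC hh.le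
  · filter_upwards [hpos] with h hh
    refine ContinuousOn.log (hFc h).continuousOn fun c hc => ?_
    linarith [(hF1 c hc.1 h hh).1]

lemma integrable_log_snrFactor (hpos : ∀ᵐ h ∂m, 0 < h)
    (hlog : Integrable (fun h => Real.log (1 + h)) m) {r c : ℝ} (hc : 0 ≤ c) :
    Integrable (fun h => Real.log (snrFactor r c h)) m :=
  integrable_log_of_le_one_add_mul hpos hlog (by fun_prop) hc
    fun _ hh => ⟨one_le_snrFactor hc hh.le, snrFactor_le⟩

lemma exists_pos_measure_Ici (hpos : ∀ᵐ h ∂m, 0 < h) : ∃ δ : ℝ, 0 < δ ∧ 0 < m.real (Ici δ) := by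
  by_contra! hcon
  have h1 : ∀ n : ℕ, m (Ici (1 / ((n : ℝ) + 1))) = 0 := by
    intro n
    have := hcon (1 / ((n : ℝ) + 1)) (by positivity)
    exact (measureReal_eq_zero_iff).1 (le_antisymm this measureReal_nonneg)
  have h2 : m (⋃ n : ℕ, Ici (1 / ((n : ℝ) + 1))) = 0 := measure_iUnion_null h1
  have h3 : ∀ᵐ h ∂m, False := by
    filter_upwards [hpos, measure_eq_zero_iff_ae_notMem.1 h2] with h hh hh2
    obtain ⟨n, hn⟩ := exists_nat_one_div_lt hh
    exact hh2 (mem_iUnion.2 ⟨n, hn.le⟩)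
  have := IsProbabilityMeasure.ne_zero m
  rw [← ae_neBot] at this
  exact h3.exists.choose_spec

/-- For each ratio `r` of water level to cap, some cap `c` makes the rate equal to `R`. -/
lemma exists_cap (hpos : ∀ᵐ h ∂m, 0 < h) (hlog : Integrable (fun h => Real.log (1 + h)) m)
    (hR : 0 < R) {r : ℝ} (hr : 1 ≤ r) :
    ∃ c, 0 < c ∧ ∫ h, Real.log (snrFactor r c h) ∂m = R := by
  obtain ⟨δ, hδ, hm⟩ := exists_pos_measure_Ici hpos
  set q := m.real (Ici δ)
  -- on `h ≥ δ` the factor is at least `C δ = exp (R / q)`, so the rate at `C` is at least `R`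
  set C := Real.exp (R / q) / δ
  have hC : 0 < C := by positivity
  have hCδ : C * δ = Real.exp (R / q) := by
    simp only [C]
    field_simp
  have hCR : R ≤ ∫ h, Real.log (snrFactor r C h) ∂m := by
    have h1 : ∫ h, (Ici δ).indicator (fun _ => R / q) h ∂m = R := by
      rw [integral_indicator measurableSet_Ici, setIntegral_const, smul_eq_mul]
      field_simp
      rfl
    rw [← h1]
    refine integral_mono_ae ((integrable_const _).indicator measurableSet_Ici)
      (integrable_log_snrFactor hpos hlog hC.le) ?_
    filter_upwards [hpos] with h hh
    by_cases hd : h ∈ Ici δ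
    · rw [indicator_of_mem hd, Real.le_log_iff_exp_le
        (by linarith [one_le_snrFactor (r := r) hC.le hh.le]), ← hCδ]
      have h2 : C * δ ≤ C * h := mul_le_mul_of_nonneg_left hd hC.le
      refine le_min (by linarith) (le_trans ?_ (le_max_right _ _))
      have : C * h ≤ r * (C * h) := le_mul_of_one_le_left (by positivity) hr
      linarith
    · rw [indicator_of_notMem hd]
      exact Real.log_nonneg (one_le_snrFactor hC.le hh.le)
  have h0 : ∫ h, Real.log (snrFactor r 0 h) ∂m = 0 := by
    simp [snrFactor]
  have hcont : ContinuousOn (fun c => ∫ h, Real.log (snrFactor r c h) ∂m) (Icc 0 C) :=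
    continuousOn_integral_log hpos hlog (fun c => by fun_prop)
      (fun c hc h hh => ⟨one_le_snrFactor hc hh.le, snrFactor_le⟩)
      (fun h => by unfold snrFactor; fun_prop)
  obtain ⟨c, hc, hcR⟩ := intermediate_value_Icc hC.le hcont
    (show R ∈ Icc _ _ from ⟨by simpa [h0] using hR.le, hCR⟩)
  refine ⟨c, lt_of_le_of_ne hc.1 ?_, hcR⟩
  rintro rfl
  simp only [h0] at hcR
  exact hR.ne hcR

/-- The rate is strictly increasing in the pair (cap, water level). -/
lemma not_lt_of_rate_eq (hpos : ∀ᵐ h ∂m, 0 < h)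
    (hlog : Integrable (fun h => Real.log (1 + h)) m) (hR : 0 < R) {r c r' c' : ℝ} (hc : 0 < c)
    (hc' : 0 < c') (h1 : ∫ h, Real.log (snrFactor r c h) ∂m = R)
    (h2 : ∫ h, Real.log (snrFactor r' c' h) ∂m = R) (hrc : r * c < r' * c') : c' ≤ c := by
  by_contra! hcc
  have hmono : ∀ h, 0 < h → snrFactor r c h = snrFactor r' c' h → snrFactor r' c' h = 1 := by
    intro h hh he
    by_contra hne
    have h3 : 1 < snrFactor r' c' h :=
      lt_of_le_of_ne (one_le_snrFactor hc'.le hh.le) (Ne.symm hne)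
    have h4 : c * h < c' * h := mul_lt_mul_of_pos_right hcc hh
    have h5 : r * c * h < r' * c' * h := mul_lt_mul_of_pos_right hrc hh
    have h6 : 1 < r' * c' * h := by
      by_contra! h7
      unfold snrFactor at h3
      rw [max_eq_left h7] at h3
      exact absurd (lt_of_lt_of_le h3 (min_le_right _ _)) (lt_irrefl _)
    have h8 : snrFactor r c h < snrFactor r' c' h := by
      unfold snrFactor
      apply min_lt_min
      · linarith
      · rw [max_eq_right h6.le]
        exact max_lt h6 h5
    exact h8.ne he
  have hle : (fun h => Real.log (snrFactor r c h)) ≤ᵐ[m] fun h => Real.log (snrFactor r' c' h) := by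
    filter_upwards [hpos] with h hh
    refine Real.log_le_log (by linarith [one_le_snrFactor (r := r) hc.le hh.le]) ?_
    unfold snrFactor
    have h4 : c * h ≤ c' * h := mul_le_mul_of_nonneg_right hcc.le hh.le
    have h5 : r * c * h ≤ r' * c' * h := mul_le_mul_of_nonneg_right hrc.le hh.le
    gcongr
  have heq := (integral_eq_iff_of_ae_le (integrable_log_snrFactor hpos hlog hc.le)
    (integrable_log_snrFactor hpos hlog hc'.le) hle).1 (h1.trans h2.symm)
  have hz : ∫ h, Real.log (snrFactor r' c' h) ∂m = 0 := by
    rw [integral_congr_ae (g := fun _ => 0)]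
    · simp
    filter_upwards [hpos, heq] with h hh he
    have := Real.log_injOn_pos (show snrFactor r c h ∈ Ioi 0 by
      exact lt_of_lt_of_le one_pos (one_le_snrFactor hc.le hh.le)) (show snrFactor r' c' h ∈ Ioi 0
      by exact lt_of_lt_of_le one_pos (one_le_snrFactor hc'.le hh.le)) he
    rw [hmono h hh this, Real.log_one]
  linarith

/-- A signal-to-noise ratio uniformly close to `0` cannot support the rate `R`. -/
lemma exists_cap_lower_bound (hpos : ∀ᵐ h ∂m, 0 < h)
    (hlog : Integrable (fun h => Real.log (1 + h)) m) (hR : 0 < R) :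
    ∃ c₁, 0 < c₁ ∧ ∀ r c, 0 < c → ∫ h, Real.log (snrFactor r c h) ∂m = R → c₁ ≤ c := by
  have hcont : ContinuousOn (fun c => ∫ h, Real.log (1 + c * h) ∂m) (Icc 0 1) :=
    continuousOn_integral_log (F := fun c h => 1 + c * h) hpos hlog (fun c => by fun_prop)
      (fun c hc h hh => ⟨by nlinarith [mul_nonneg hc hh.le], le_rfl⟩) (fun h => by fun_prop)
  have h0 := hcont 0 (by simp)
  have h1 : ∀ᶠ c in nhdsWithin (0 : ℝ) (Icc 0 1), ∫ h, Real.log (1 + c * h) ∂m < R := by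
    apply h0.eventually_lt_const
    simpa using hR
  rw [nhdsWithin_Icc_eq_nhdsGE one_pos] at h1
  have h2 : ∀ᶠ c in nhdsWithin (0 : ℝ) (Ioi 0), ∫ h, Real.log (1 + c * h) ∂m < R :=
    h1.filter_mono (nhdsWithin_mono _ Ioi_subset_Ici_self)
  obtain ⟨c₁, hc₁, hpos₁⟩ := (h2.and self_mem_nhdsWithin).exists
  refine ⟨c₁, hpos₁, fun r c hc hcR => ?_⟩
  by_contra! hlt
  have h3 : ∫ h, Real.log (snrFactor r c h) ∂m ≤ ∫ h, Real.log (1 + c₁ * h) ∂m := by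
    refine integral_mono_ae (integrable_log_snrFactor hpos hlog hc.le)
      (integrable_log_of_le_one_add_mul hpos hlog (by fun_prop) (le_of_lt hpos₁)
        fun h hh => ⟨by nlinarith [mul_pos (show 0 < c₁ from hpos₁) hh], le_rfl⟩) ?_
    filter_upwards [hpos] with h hh
    refine Real.log_le_log (by linarith [one_le_snrFactor (r := r) hc.le hh.le]) ?_
    exact snrFactor_le.trans (by nlinarith)
  linarith

lemma noiseFactor_le {r c h : ℝ} (hr : 1 ≤ r) (hc : 0 < c) (hh : 0 < h) :
    noiseFactor r c h ≤ r := by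
  refine max_le hr ?_
  have : c * h / (1 + c * h) ≤ 1 := by
    rw [div_le_one (by positivity)]
    linarith
  nlinarith

lemma integrable_noiseFactor (hpos : ∀ᵐ h ∂m, 0 < h) {r c : ℝ} (hr : 1 ≤ r) (hc : 0 < c) :
    Integrable (fun h => noiseFactor r c h) m := by
  refine Integrable.mono' (integrable_const r)
    (Measurable.aestronglyMeasurable (by fun_prop)) ?_
  filter_upwards [hpos] with h hh
  rw [Real.norm_of_nonneg (by linarith [one_le_noiseFactor (r := r) (c := c) (h := h)])]
  exact noiseFactor_le hr hc hh

lemma monotone_noise_ratio {x y : ℝ} (hx : 0 ≤ x) (hxy : x ≤ y) : x / (1 + x) ≤ y / (1 + y) := by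
  rw [div_le_div_iff₀ (by linarith) (by linarith)]
  nlinarith

/-- The saddle points `(r, c)` that support the rate `R` exist for every jamming power `y`, and
along them the water level rises and the cap falls as `y` grows. -/
theorem exists_saddle_curve (hpos : ∀ᵐ h ∂m, 0 < h)
    (hlog : Integrable (fun h => Real.log (1 + h)) m) (hR : 0 < R) {N : ℝ} (hN : 0 < N) :
    ∃ r c : ℝ≥0 → ℝ, ∃ c₁ : ℝ, 0 < c₁ ∧ Monotone r ∧ Antitone c ∧ (∀ y, 1 ≤ r y) ∧
      (∀ y, c₁ ≤ c y) ∧ (∀ y, ∫ h, Real.log (snrFactor (r y) (c y) h) ∂m = R) ∧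
      ∀ y : ℝ≥0, ∫ h, N * (noiseFactor (r y) (c y) h - 1) ∂m = y := by
  obtain ⟨c₁, hc₁, hc₁le⟩ := exists_cap_lower_bound (m := m) hpos hlog hR
  have hex : ∀ r : ℝ, ∃ c, 1 ≤ r → 0 < c ∧ ∫ h, Real.log (snrFactor r c h) ∂m = R := by
    intro r
    by_cases hr : 1 ≤ r
    · obtain ⟨c, hc⟩ := exists_cap hpos hlog hR hr
      exact ⟨c, fun _ => hc⟩
    · exact ⟨0, fun h => absurd h hr⟩
  choose c hc using hex
  have hanti : ∀ r r', 1 ≤ r → r ≤ r' → c r' ≤ c r := by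
    intro r r' hr hrr
    rcases hrr.eq_or_lt with rfl | hlt
    · exact le_rfl
    by_contra! hcc
    obtain ⟨h1, h2⟩ := hc r hr
    obtain ⟨h3, h4⟩ := hc r' (hr.trans hrr)
    exact absurd (not_lt_of_rate_eq hpos hlog hR h1 h3 h2 h4 (by nlinarith)) (not_le.2 hcc)
  have hmono : ∀ r r', 1 ≤ r → r ≤ r' → r * c r ≤ r' * c r' := by
    intro r r' hr hrr
    by_contra! hlt
    obtain ⟨h1, h2⟩ := hc r hr
    obtain ⟨h3, h4⟩ := hc r' (hr.trans hrr)
    have h5 := not_lt_of_rate_eq hpos hlog hR h3 h1 h4 h2 hlt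
    nlinarith
  -- the jamming power along the curve
  set B : ℝ → ℝ := fun r => ∫ h, N * (noiseFactor r (c r) h - 1) ∂m with hB
  have hint : ∀ r, 1 ≤ r → Integrable (fun h => N * (noiseFactor r (c r) h - 1)) m := fun r hr =>
    ((integrable_noiseFactor hpos hr (hc r hr).1).sub (integrable_const 1)).const_mul N
  have hBmono : ∀ r r', 1 ≤ r → r ≤ r' → B r ≤ B r' := by
    intro r r' hr hrr
    have hr' := hr.trans hrr
    refine integral_mono_ae (hint r hr) (hint r' hr') ?_
    filter_upwards [hpos] with h hh
    have h1 := (hc r hr).1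
    have h2 := (hc r' hr').1
    have h3 := hanti r r' hr hrr
    have h4 := hmono r r' hr hrr
    have h5 : r * (c r * h / (1 + c r * h)) ≤ r' * (c r' * h / (1 + c r' * h)) := by
      rw [show r * (c r * h / (1 + c r * h)) = r * c r * h / (1 + c r * h) by ring,
        show r' * (c r' * h / (1 + c r' * h)) = r' * c r' * h / (1 + c r' * h) by ring]
      have : 0 < 1 + c r' * h := by positivity
      gcongr
    unfold noiseFactor
    gcongr
  -- in `K = max 1 (r * (c h / (1 + c h)))` the inner ratio is at most `1` and falls with `c`
  have hBlip : ∀ r r', 1 ≤ r → r ≤ r' → B r' ≤ B r + N * (r' - r) := by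
    intro r r' hr hrr
    have hr' := hr.trans hrr
    have h0 : B r + N * (r' - r) = ∫ h, (N * (noiseFactor r (c r) h - 1) + N * (r' - r)) ∂m := by
      rw [integral_add (hint r hr) (integrable_const _)]
      simp [hB]
    rw [h0]
    refine integral_mono_ae (hint r' hr') ((hint r hr).add (integrable_const _)) ?_
    filter_upwards [hpos] with h hh
    have h1 := (hc r hr).1
    have h2 := (hc r' hr').1
    have h3 := hanti r r' hr hrr
    have h5 : c r' * h / (1 + c r' * h) ≤ c r * h / (1 + c r * h) :=
      monotone_noise_ratio (by positivity) (by gcongr)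
    have h6 : c r * h / (1 + c r * h) ≤ 1 := by
      rw [div_le_one (by positivity)]
      linarith
    have h7 : noiseFactor r' (c r') h ≤ noiseFactor r (c r) h + (r' - r) := by
      refine max_le ?_ ?_
      · linarith [one_le_noiseFactor (r := r) (c := c r) (h := h)]
      · have h8 : r * (c r * h / (1 + c r * h)) ≤ noiseFactor r (c r) h := le_max_right _ _
        nlinarith
    have h8 := mul_le_mul_of_nonneg_left h7 hN.le
    linarith
  have hBcont : ContinuousOn B (Ici 1) := by
    refine LipschitzOnWith.continuousOn (K := N.toNNReal) (LipschitzOnWith.of_dist_le_mul ?_)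
    intro x hx y hy
    rw [Real.coe_toNNReal _ hN.le, Real.dist_eq, Real.dist_eq]
    rcases le_total x y with hxy | hxy
    · have h1 := hBmono x y hx hxy
      have h2 := hBlip x y hx hxy
      rw [abs_of_nonpos (by linarith), abs_of_nonpos (by linarith)]
      linarith
    · have h1 := hBmono y x hy hxy
      have h2 := hBlip y x hy hxy
      rw [abs_of_nonneg (by linarith), abs_of_nonneg (by linarith)]
      linarith
  have hB1 : B 1 = 0 := by
    simp only [hB]
    rw [integral_congr_ae (g := fun _ => 0)]
    · simp
    filter_upwards [hpos] with h hh
    have h1 : noiseFactor 1 (c 1) h = 1 :=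
      le_antisymm (noiseFactor_le le_rfl (hc 1 le_rfl).1 hh) one_le_noiseFactor
    simp [h1]
  -- the cap stays above `c₁`, so the jamming power grows at least linearly in `r`
  have hθint : Integrable (fun h => c₁ * h / (1 + c₁ * h)) m := by
    refine Integrable.mono' (integrable_const 1)
      (Measurable.aestronglyMeasurable (by fun_prop)) ?_
    filter_upwards [hpos] with h hh
    rw [Real.norm_of_nonneg (by positivity), div_le_one (by positivity)]
    linarith
  set θ := ∫ h, c₁ * h / (1 + c₁ * h) ∂m with hθdef
  have hθ : 0 < θ := by
    have hnn : 0 ≤ᵐ[m] fun h => c₁ * h / (1 + c₁ * h) := by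
      filter_upwards [hpos] with h hh
      simp only [Pi.zero_apply]
      positivity
    refine lt_of_le_of_ne (integral_nonneg_of_ae hnn) fun h0 => ?_
    have h1 := (integral_eq_zero_iff_of_nonneg_ae hnn hθint).1 h0.symm
    obtain ⟨h, hh, hh1⟩ := (hpos.and h1).exists
    have : 0 < c₁ * h / (1 + c₁ * h) := by positivity
    simp only [Pi.zero_apply] at hh1
    exact this.ne' hh1
  have hBlarge : ∀ r, 1 ≤ r → N * (r * θ - 1) ≤ B r := by
    intro r hr
    have h0 : N * (r * θ - 1) = ∫ h, N * (r * (c₁ * h / (1 + c₁ * h)) - 1) ∂m := by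
      rw [integral_const_mul, integral_sub (hθint.const_mul r) (integrable_const _),
        integral_const_mul]
      simp [hθdef]
    rw [h0]
    refine integral_mono_ae (((hθint.const_mul r).sub (integrable_const 1)).const_mul N)
      (hint r hr) ?_
    filter_upwards [hpos] with h hh
    have h2 := hc₁le r (c r) (hc r hr).1 (hc r hr).2
    have h5 : c₁ * h / (1 + c₁ * h) ≤ c r * h / (1 + c r * h) :=
      monotone_noise_ratio (by positivity) (by gcongr)
    have h6 : r * (c₁ * h / (1 + c₁ * h)) ≤ noiseFactor r (c r) h :=
      le_trans (mul_le_mul_of_nonneg_left h5 (by linarith)) (le_max_right _ _)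
    have := mul_le_mul_of_nonneg_left h6 hN.le
    linarith
  have hsurj : ∀ y : ℝ≥0, ∃ r, 1 ≤ r ∧ B r = y := by
    intro y
    obtain ⟨r, hr⟩ : ∃ r, r = max 1 ((y / N + 1) / θ) := ⟨_, rfl⟩
    have hr1 : 1 ≤ r := hr ▸ le_max_left _ _
    have hr2 : (y / N + 1) / θ ≤ r := hr ▸ le_max_right _ _
    have h1 : (y : ℝ) ≤ B r := by
      refine le_trans ?_ (hBlarge r hr1)
      rw [div_le_iff₀ hθ] at hr2
      have := mul_le_mul_of_nonneg_left hr2 hN.le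
      have e : N * (y / N + 1) = y + N := by field_simp
      linarith
    obtain ⟨s, hs, hsy⟩ := intermediate_value_Icc hr1 (hBcont.mono Icc_subset_Ici_self)
      (show (y : ℝ) ∈ Icc _ _ from ⟨by rw [hB1]; exact y.2, h1⟩)
    exact ⟨s, hs.1, hsy⟩
  choose ρ hρ1 hρ2 using hsurj
  have hρmono : Monotone ρ := by
    intro y y' hyy
    rcases hyy.eq_or_lt with rfl | hlt
    · exact le_rfl
    by_contra! h
    have := hBmono _ _ (hρ1 y') h.le
    rw [hρ2, hρ2] at this
    exact absurd hlt (not_lt.2 (by exact_mod_cast this))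
  exact ⟨ρ, fun y => c (ρ y), c₁, hc₁, hρmono, fun y y' h => hanti _ _ (hρ1 y) (hρmono h), hρ1,
    fun y => hc₁le _ _ (hc _ (hρ1 y)).1 (hc _ (hρ1 y)).2, fun y => (hc _ (hρ1 y)).2, hρ2⟩

end Curve

/-! ### Saddle-point allocations within a frame -/

/-- Saddle points of the game within a frame, one for each jamming power `y`: allocations `tx y` of
power `level y` and `jam y` of power `y` such that `tx y` supports the rate `R` against any jammer
of power `y`, and `jam y` leaves no chance to a transmitter of power less than `level y`.
The `slope y` is the cap on the signal-to-noise ratio at the saddle point; scaling the noise by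
that ratio answers every jammer at an affine cost (`response`), so that the slope is a
supergradient of `level` at `y`. -/
structure SaddleFamily (m : Measure ℝ) (N R : ℝ) where
  level : ℝ≥0 → ℝ≥0
  slope : ℝ≥0 → ℝ≥0
  minSlope : ℝ≥0
  tx : ℝ≥0 → ℝ → ℝ≥0
  jam : ℝ≥0 → ℝ → ℝ≥0
  minSlope_pos : 0 < minSlope
  minSlope_le : ∀ y, minSlope ≤ slope y
  antitone_slope : Antitone slope
  level_zero_pos : 0 < level 0
  measurable_tx : Measurable fun z : ℝ≥0 × ℝ => tx z.1 z.2
  measurable_jam : Measurable fun z : ℝ≥0 × ℝ => jam z.1 z.2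
  mean_tx : ∀ y, meanPower m (tx y) = level y
  mean_jam : ∀ y, meanPower m (jam y) = y
  tx_secure : ∀ (y : ℝ≥0) J, Measurable J → meanPower m J ≤ y →
    ENNReal.ofReal R ≤ capacity m N (tx y) J
  jam_secure : ∀ (y : ℝ≥0) P, Measurable P → ENNReal.ofReal R ≤ capacity m N P (jam y) →
    (level y : ℝ≥0∞) ≤ meanPower m P
  response : ∀ (y : ℝ≥0) J, Measurable J → ∃ P, Measurable P ∧ ENNReal.ofReal R ≤ capacity m N P J ∧
    meanPower m P + slope y * y ≤ level y + slope y * meanPower m J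

section Construction

variable {m : Measure ℝ} {R N : ℝ}

lemma lintegral_add_meanPower_le {a b : ℝ → ℝ} {u w : ℝ → ℝ≥0} {κ : ℝ} (hκ : 0 ≤ κ)
    (ha : Measurable a) (hb : Measurable b) (ha0 : ∀ᵐ h ∂m, 0 ≤ a h) (hb0 : ∀ᵐ h ∂m, 0 ≤ b h)
    (hle : ∀ᵐ h ∂m, a h + u h * κ ≤ b h + w h * κ) :
    ∫⁻ h, ENNReal.ofReal (a h) ∂m + ENNReal.ofReal κ * meanPower m u
      ≤ ∫⁻ h, ENNReal.ofReal (b h) ∂m + ENNReal.ofReal κ * meanPower m w := by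
  unfold meanPower
  rw [← lintegral_const_mul' _ _ ENNReal.ofReal_ne_top,
    ← lintegral_const_mul' _ _ ENNReal.ofReal_ne_top,
    ← lintegral_add_left ha.ennreal_ofReal, ← lintegral_add_left hb.ennreal_ofReal]
  refine lintegral_mono_ae ?_
  filter_upwards [ha0, hb0, hle] with h h1 h2 h3
  rw [← ENNReal.ofReal_coe_nnreal, ← ENNReal.ofReal_coe_nnreal (p := w h),
    ← ENNReal.ofReal_mul hκ, ← ENNReal.ofReal_mul hκ,
    ← ENNReal.ofReal_add h1 (mul_nonneg hκ (u h).coe_nonneg),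
    ← ENNReal.ofReal_add h2 (mul_nonneg hκ (w h).coe_nonneg)]
  exact ENNReal.ofReal_le_ofReal (by linarith)

lemma measurable_rate {P J : ℝ → ℝ≥0} (hP : Measurable P) (hJ : Measurable J) :
    Measurable fun h => Real.log (1 + h * (P h : ℝ) / (N + (J h : ℝ))) := by
  fun_prop

lemma rate_nonneg (hN : 0 < N) (P J : ℝ → ℝ≥0) {h : ℝ} (hh : 0 ≤ h) :
    0 ≤ Real.log (1 + h * (P h : ℝ) / (N + (J h : ℝ))) := by
  apply Real.log_nonneg
  have : 0 ≤ h * (P h : ℝ) / (N + (J h : ℝ)) := by positivity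
  linarith

theorem nonempty_saddleFamily [IsProbabilityMeasure m] (hpos : ∀ᵐ h ∂m, 0 < h)
    (hlog : Integrable (fun h => Real.log (1 + h)) m) (hR : 0 < R) (hN : 0 < N) :
    Nonempty (SaddleFamily m N R) := by
  obtain ⟨r, c, c₁, hc₁, hrmono, hcanti, hr1, hcc, hrate, hjam⟩ :=
    exists_saddle_curve hpos hlog hR hN
  have hc0 : ∀ y, 0 < c y := fun y => hc₁.trans_le (hcc y)
  have hr0 : ∀ y, 0 < r y := fun y => one_pos.trans_le (hr1 y)
  have hrm : Measurable r := hrmono.measurable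
  have hcm : Measurable c := hcanti.measurable
  -- the signal-to-noise ratio `Z = (W - 1) / h` at the saddle point
  set Z : ℝ≥0 → ℝ → ℝ := fun y h => (snrFactor (r y) (c y) h - 1) / h with hZ
  have hZm : ∀ y, Measurable (Z y) := fun y => by simp only [hZ]; fun_prop
  have hZ0 : ∀ y h, 0 < h → 0 ≤ Z y h := fun y h hh =>
    div_nonneg (by linarith [one_le_snrFactor (r := r y) (hc0 y).le hh.le]) hh.le
  have hZc : ∀ y h, 0 < h → Z y h ≤ c y := fun y h hh => by
    simp only [hZ]
    rw [div_le_iff₀ hh]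
    linarith [snrFactor_le (r := r y) (c := c y) (h := h)]
  have hZW : ∀ y h, 0 < h → h * Z y h = snrFactor (r y) (c y) h - 1 := fun y h hh => by
    simp only [hZ]
    field_simp
  have hZint : ∀ y, Integrable (Z y) m := fun y => by
    refine Integrable.mono' (integrable_const (c y)) (hZm y).aestronglyMeasurable ?_
    filter_upwards [hpos] with h hh
    rw [Real.norm_of_nonneg (hZ0 y h hh)]
    exact hZc y h hh
  have hZpos : ∀ y, 0 < ∫ h, Z y h ∂m := fun y => by
    have hnn : 0 ≤ᵐ[m] Z y := by
      filter_upwards [hpos] with h hh using hZ0 y h hh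
    refine lt_of_le_of_ne (integral_nonneg_of_ae hnn) fun h0 => ?_
    have h1 := (integral_eq_zero_iff_of_nonneg_ae hnn (hZint y)).1 h0.symm
    have h2 : ∫ h, Real.log (snrFactor (r y) (c y) h) ∂m = 0 := by
      rw [integral_congr_ae (g := fun _ => 0)]
      · simp
      filter_upwards [hpos, h1] with h hh hz
      have := hZW y h hh
      rw [hz] at this
      rw [show snrFactor (r y) (c y) h = 1 by simp only [Pi.zero_apply] at this; linarith,
        Real.log_one]
    linarith [hrate y]
  set K : ℝ≥0 → ℝ → ℝ := fun y h => noiseFactor (r y) (c y) h with hK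
  have hK1 : ∀ y h, 1 ≤ K y h := fun y h => one_le_noiseFactor
  have hKint : ∀ y, Integrable (fun h => N * (K y h - 1)) m := fun y =>
    ((integrable_noiseFactor hpos (hr1 y) (hc0 y)).sub (integrable_const 1)).const_mul N
  have hKZ : ∀ y h, 0 < h → N * K y h * Z y h = N * Z y h + c y * (N * (K y h - 1)) := by
    intro y h hh
    rcases (hK1 y h).eq_or_lt with h1 | h1
    · rw [← h1]
      ring
    · have h2 : Z y h = c y := by
        simp only [hZ]
        rw [(snrFactor_eq_of_one_lt (hc0 y) hh h1).1]
        field_simp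
        ring
      rw [h2]
      ring
  set tx : ℝ≥0 → ℝ → ℝ≥0 := fun y h => (N * K y h * Z y h).toNNReal with htx
  set jam : ℝ≥0 → ℝ → ℝ≥0 := fun y h => (N * (K y h - 1)).toNNReal with hjamdef
  set level : ℝ≥0 → ℝ≥0 := fun y => (N * ∫ h, Z y h ∂m).toNNReal + (c y).toNNReal * y with hlevel
  have htxm : Measurable fun z : ℝ≥0 × ℝ => tx z.1 z.2 := by
    simp only [htx, hZ, hK]
    fun_prop
  have hjamm : Measurable fun z : ℝ≥0 × ℝ => jam z.1 z.2 := by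
    simp only [hjamdef, hK]
    fun_prop
  have htxcoe : ∀ y h, 0 < h → (tx y h : ℝ) = N * K y h * Z y h := fun y h hh =>
    Real.coe_toNNReal _ (mul_nonneg (mul_nonneg hN.le (by linarith [hK1 y h])) (hZ0 y h hh))
  have hjamcoe : ∀ y h, (jam y h : ℝ) = N * (K y h - 1) := fun y h =>
    Real.coe_toNNReal _ (mul_nonneg hN.le (by linarith [hK1 y h]))
  have hlogW : ∀ y, ∫⁻ h, ENNReal.ofReal (Real.log (snrFactor (r y) (c y) h)) ∂m
      = ENNReal.ofReal R := fun y => by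
    rw [← ofReal_integral_eq_lintegral_ofReal (integrable_log_snrFactor hpos hlog (hc0 y).le) _,
      hrate]
    filter_upwards [hpos] with h hh
    exact Real.log_nonneg (one_le_snrFactor (hc0 y).le hh.le)
  have hW0 : ∀ y, ∀ᵐ h ∂m, 0 ≤ Real.log (snrFactor (r y) (c y) h) := fun y => by
    filter_upwards [hpos] with h hh
    exact Real.log_nonneg (one_le_snrFactor (hc0 y).le hh.le)
  have hmeanjam : ∀ y, meanPower m (jam y) = y := fun y => by
    have h1 : meanPower m (jam y) = ∫⁻ h, ENNReal.ofReal (N * (K y h - 1)) ∂m := rfl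
    rw [h1, ← ofReal_integral_eq_lintegral_ofReal (hKint y), hjam, ENNReal.ofReal_coe_nnreal]
    exact Filter.Eventually.of_forall fun h => mul_nonneg hN.le (by linarith [hK1 y h])
  have hmeanZ : ∀ y, ∫⁻ h, ENNReal.ofReal (N * Z y h) ∂m
      = ENNReal.ofReal (N * ∫ h, Z y h ∂m) := fun y => by
    rw [← ofReal_integral_eq_lintegral_ofReal ((hZint y).const_mul N), integral_const_mul]
    filter_upwards [hpos] with h hh using mul_nonneg hN.le (hZ0 y h hh)
  have hmeantx : ∀ y, meanPower m (tx y) = level y := fun y => by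
    have h1 : meanPower m (tx y)
        = ∫⁻ h, (ENNReal.ofReal (N * Z y h) + ENNReal.ofReal (c y) * (jam y h : ℝ≥0∞)) ∂m := by
      refine lintegral_congr_ae ?_
      filter_upwards [hpos] with h hh
      rw [← ENNReal.ofReal_coe_nnreal, ← ENNReal.ofReal_coe_nnreal (p := jam y h), htxcoe y h hh,
        hjamcoe y h, hKZ y h hh, ENNReal.ofReal_add (mul_nonneg hN.le (hZ0 y h hh))
          (mul_nonneg (hc0 y).le (mul_nonneg hN.le (by linarith [hK1 y h]))),
        ENNReal.ofReal_mul (hc0 y).le]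
    rw [h1, lintegral_add_left ((hZm y).const_mul N).ennreal_ofReal,
      lintegral_const_mul' _ _ ENNReal.ofReal_ne_top, hmeanZ]
    have h2 := hmeanjam y
    unfold meanPower at h2
    rw [h2]
    simp only [hlevel]
    push_cast
    rfl
  refine ⟨⟨level, fun y => (c y).toNNReal, c₁.toNNReal, tx, jam, Real.toNNReal_pos.2 hc₁,
    fun y => Real.toNNReal_le_toNNReal (hcc y), fun y y' h => Real.toNNReal_le_toNNReal (hcanti h),
    ?_, htxm, hjamm, hmeantx, hmeanjam, ?_, ?_, ?_⟩⟩
  · simp only [hlevel, mul_zero, add_zero]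
    exact Real.toNNReal_pos.2 (mul_pos hN (hZpos 0))
  · intro y J hJ hJy
    have hκ : 0 ≤ 1 / (N * r y) := by have := hr0 y; positivity
    have h1 := lintegral_add_meanPower_le (m := m) (u := jam y) (w := J) hκ
      (a := fun h => Real.log (snrFactor (r y) (c y) h))
      (b := fun h => Real.log (1 + h * (tx y h : ℝ) / (N + (J h : ℝ)))) (by fun_prop)
      (measurable_rate (htxm.comp measurable_prodMk_left) hJ) (hW0 y)
      (by filter_upwards [hpos] with h hh using rate_nonneg hN _ _ hh.le) (by
        filter_upwards [hpos] with h hh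
        have := log_snrFactor_add_le hN (hr1 y) (hc0 y) hh (J h).2
        rw [hjamcoe, htxcoe y h hh, mul_one_div, mul_one_div]
        exact this)
    rw [hlogW, hmeanjam] at h1
    have h2 : ENNReal.ofReal (1 / (N * r y)) * meanPower m J
        ≤ ENNReal.ofReal (1 / (N * r y)) * y := by gcongr
    exact (ENNReal.add_le_add_iff_right
      (ENNReal.mul_ne_top ENNReal.ofReal_ne_top ENNReal.coe_ne_top)).1
        (h1.trans (add_le_add_right h2 _))
  · intro y P hP hRP
    have hκ : 0 < 1 / (N * r y * c y) := by
      have := hr0 y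
      have := hc0 y
      positivity
    have h1 := lintegral_add_meanPower_le (m := m) (u := tx y) (w := P) hκ.le
      (b := fun h => Real.log (snrFactor (r y) (c y) h))
      (a := fun h => Real.log (1 + h * (P h : ℝ) / (N + (jam y h : ℝ))))
      (measurable_rate hP (hjamm.comp measurable_prodMk_left)) (by fun_prop)
      (by filter_upwards [hpos] with h hh using rate_nonneg hN _ _ hh.le) (hW0 y) (by
        filter_upwards [hpos] with h hh
        have := log_rate_add_le hN (hr1 y) (hc0 y) hh (P h).2
        rw [hjamcoe, htxcoe y h hh, mul_one_div, mul_one_div,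
          show N + N * (K y h - 1) = N * K y h by ring]
        exact this)
    rw [hlogW, hmeantx] at h1
    have h2 : ENNReal.ofReal R + ENNReal.ofReal (1 / (N * r y * c y)) * level y
        ≤ ENNReal.ofReal R + ENNReal.ofReal (1 / (N * r y * c y)) * meanPower m P :=
      le_trans (add_le_add_left hRP _) h1
    have h3 := (ENNReal.add_le_add_iff_left ENNReal.ofReal_ne_top).1 h2
    exact (ENNReal.mul_le_mul_iff_right (ENNReal.ofReal_pos.2 hκ).ne' ENNReal.ofReal_ne_top).1 h3
  · intro y J hJ
    refine ⟨fun h => (N.toNNReal + J h) * (Z y h).toNNReal,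
      (measurable_const.add hJ).mul (hZm y).real_toNNReal, ?_, ?_⟩
    · rw [← hlogW y]
      refine lintegral_mono_ae ?_
      filter_upwards [hpos] with h hh
      apply ENNReal.ofReal_le_ofReal
      apply le_of_eq
      have : (0 : ℝ) < N + J h := by positivity
      push_cast
      rw [Real.coe_toNNReal _ hN.le, Real.coe_toNNReal _ (hZ0 y h hh)]
      congr 1
      have h1 := hZW y h hh
      field_simp
      linarith
    · have h1 : meanPower m (fun h => (N.toNNReal + J h) * (Z y h).toNNReal)
          ≤ ENNReal.ofReal (N * ∫ h, Z y h ∂m) + ENNReal.ofReal (c y) * meanPower m J := by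
        rw [← hmeanZ, meanPower, meanPower, ← lintegral_const_mul' _ _ ENNReal.ofReal_ne_top,
          ← lintegral_add_left ((hZm y).const_mul N).ennreal_ofReal]
        refine lintegral_mono_ae ?_
        filter_upwards [hpos] with h hh
        have h2 : ENNReal.ofReal (Z y h) ≤ ENNReal.ofReal (c y) :=
          ENNReal.ofReal_le_ofReal (hZc y h hh)
        push_cast
        rw [add_mul, ENNReal.ofReal_mul hN.le, mul_comm (J h : ℝ≥0∞)]
        exact add_le_add le_rfl (mul_le_mul_left h2 _)
      refine (add_le_add_left h1 _).trans (le_of_eq ?_)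
      simp only [hlevel]
      push_cast
      rw [ENNReal.ofReal, ENNReal.ofReal]
      ring

end Construction

/-! ### The required-power curves -/

namespace SaddleFamily

variable {m : Measure ℝ} {N R : ℝ} (F : SaddleFamily m N R)

lemma level_add_le (y y' : ℝ≥0) :
    (F.level y' : ℝ) ≤ F.level y + F.slope y * ((y' : ℝ) - y) := by
  obtain ⟨P, hP, hRP, hle⟩ := F.response y (F.jam y') (F.measurable_jam.comp measurable_prodMk_left)
  have h1 := F.jam_secure y' P hP hRP
  rw [F.mean_jam] at hle
  have h2 : (F.level y' : ℝ≥0∞) + F.slope y * y ≤ F.level y + F.slope y * y' :=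
    (add_le_add_left h1 _).trans hle
  have h3 : F.level y' + F.slope y * y ≤ F.level y + F.slope y * y' := by exact_mod_cast h2
  have h4 : (F.level y' : ℝ) + F.slope y * y ≤ F.level y + F.slope y * y' := by exact_mod_cast h3
  linarith

lemma level_add_minSlope_le {y y' : ℝ≥0} (h : y ≤ y') :
    (F.level y : ℝ) + F.minSlope * ((y' : ℝ) - y) ≤ F.level y' := by
  have h1 := F.level_add_le y' y
  have h2 : (F.minSlope : ℝ) ≤ F.slope y' := by exact_mod_cast F.minSlope_le y'
  have h3 : (y : ℝ) ≤ y' := by exact_mod_cast h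
  nlinarith [mul_le_mul_of_nonneg_right h2 (sub_nonneg.2 h3)]

lemma strictMono_level : StrictMono F.level := by
  intro y y' h
  have h1 := F.level_add_minSlope_le h.le
  have h2 : (0 : ℝ) < F.minSlope := by exact_mod_cast F.minSlope_pos
  have h3 : (y : ℝ) < y' := by exact_mod_cast h
  have h4 : (F.level y : ℝ) < F.level y' := by nlinarith [mul_pos h2 (sub_pos.2 h3)]
  exact_mod_cast h4

lemma continuous_level : Continuous F.level := by
  have hle : ∀ y y' : ℝ≥0, y ≤ y' →
      dist (F.level y) (F.level y') ≤ F.slope 0 * dist y y' := by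
    intro y y' h
    have h1 := F.level_add_le y y'
    have h2 : (F.slope y : ℝ) ≤ F.slope 0 := by exact_mod_cast F.antitone_slope (zero_le (a := y))
    have h3 : (y : ℝ) ≤ y' := by exact_mod_cast h
    have h4 : (F.level y : ℝ) ≤ F.level y' := by exact_mod_cast F.strictMono_level.monotone h
    rw [NNReal.dist_eq, NNReal.dist_eq, abs_of_nonpos (by linarith), abs_of_nonpos (by linarith)]
    nlinarith [mul_le_mul_of_nonneg_right h2 (sub_nonneg.2 h3)]
  refine (LipschitzWith.of_dist_le_mul (K := F.slope 0) fun y y' => ?_).continuous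
  rcases le_total y y' with h | h
  · exact hle y y' h
  · rw [dist_comm, dist_comm y]
    exact hle y' y h

lemma exists_le_level (x : ℝ≥0) : ∃ y, x ≤ F.level y := by
  refine ⟨x / F.minSlope, ?_⟩
  have h1 := F.level_add_minSlope_le (zero_le (a := x / F.minSlope))
  have h2 : (0 : ℝ) < F.minSlope := by exact_mod_cast F.minSlope_pos
  have h3 : (x : ℝ) ≤ F.level (x / F.minSlope) := by
    push_cast at h1
    have h4 : (F.minSlope : ℝ) * (x / F.minSlope - 0) = x := by field_simp; ring
    rw [h4] at h1
    linarith [(F.level 0).coe_nonneg]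
  exact_mod_cast h3

lemma exists_level_eq {x : ℝ≥0} (hx : F.level 0 ≤ x) : ∃ y, F.level y = x := by
  obtain ⟨w, hw⟩ := F.exists_le_level x
  obtain ⟨y, -, hy⟩ := intermediate_value_Icc (zero_le (a := w)) F.continuous_level.continuousOn
    (show x ∈ Icc _ _ from ⟨hx, hw⟩)
  exact ⟨y, hy⟩

/-- The curve is concave with `level 0 ≥ 0`, hence lies above its chords from the origin. -/
lemma mul_level_le {y w : ℝ≥0} (h : y ≤ w) : (y : ℝ) * F.level w ≤ w * F.level y := by
  have h1 := F.level_add_le y w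
  have h2 := F.level_add_le y 0
  have h3 : (y : ℝ) ≤ w := by exact_mod_cast h
  have h4 := (F.level 0).coe_nonneg
  push_cast at h2
  nlinarith [mul_le_mul_of_nonneg_left h1 y.coe_nonneg,
    mul_le_mul_of_nonneg_left h2 (sub_nonneg.2 h3), mul_nonneg h4 (sub_nonneg.2 h3)]

theorem requiredTx_eq (y : ℝ≥0) : requiredTx m N R y = F.level y := by
  apply le_antisymm
  · refine iSup₂_le fun J hJ => ?_
    obtain ⟨P, hP, hRP, hle⟩ := F.response y J hJ.1
    refine (iInf₂_le P ⟨hP, hRP⟩).trans ?_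
    have h1 : (F.slope y : ℝ≥0∞) * meanPower m J ≤ F.slope y * y := mul_le_mul_right hJ.2 _
    exact (ENNReal.add_le_add_iff_right (ENNReal.mul_ne_top ENNReal.coe_ne_top
      ENNReal.coe_ne_top)).1 (hle.trans (add_le_add_right h1 _))
  · refine le_trans ?_ (le_iSup₂ (F.jam y)
      ⟨F.measurable_jam.comp measurable_prodMk_left, (F.mean_jam y).le⟩)
    exact le_iInf₂ fun P hP => F.jam_secure y P hP.1 hP.2

lemma mul_capacity_le (hN : 0 < N) (hpos : ∀ᵐ h ∂m, 0 < h) (P J : ℝ → ℝ≥0) {t : ℝ≥0}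
    (ht : t ≤ 1) : t * capacity m N P J ≤ capacity m N (fun h => t * P h) J := by
  unfold capacity
  rw [← lintegral_const_mul' _ _ ENNReal.coe_ne_top]
  refine lintegral_mono_ae ?_
  filter_upwards [hpos] with h hh
  rw [← ENNReal.ofReal_coe_nnreal, ← ENNReal.ofReal_mul t.coe_nonneg]
  apply ENNReal.ofReal_le_ofReal
  have hs : 0 ≤ h * (P h : ℝ) / (N + (J h : ℝ)) := by positivity
  have e : h * ((t * P h : ℝ≥0) : ℝ) / (N + (J h : ℝ)) = t * (h * (P h : ℝ) / (N + (J h : ℝ))) := by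
    push_cast
    ring
  rw [e, ← Real.log_rpow (by linarith)]
  exact Real.log_le_log (by positivity)
    (rpow_one_add_le_one_add_mul_self (by linarith) t.coe_nonneg (by exact_mod_cast ht))

/-- Against `jam y`, power `level y` supports no rate above `R`: otherwise a smaller multiple of
the same allocation would still support `R`. -/
lemma capacity_jam_le (hN : 0 < N) (hpos : ∀ᵐ h ∂m, 0 < h) {y : ℝ≥0} {P : ℝ → ℝ≥0}
    (hP : Measurable P) (hle : meanPower m P ≤ F.level y) :
    capacity m N P (F.jam y) ≤ ENNReal.ofReal R := by
  by_contra! hlt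
  obtain ⟨C, hRC, hC⟩ := exists_between hlt
  have hC0 : C ≠ 0 := (bot_le.trans_lt hRC).ne'
  have hCt : C ≠ ∞ := hC.ne_top
  obtain ⟨t, ht⟩ : ∃ t : ℝ≥0, (t : ℝ≥0∞) = ENNReal.ofReal R / C :=
    ⟨(ENNReal.ofReal R / C).toNNReal, ENNReal.coe_toNNReal
      (ENNReal.div_ne_top ENNReal.ofReal_ne_top hC0)⟩
  have ht1 : t < 1 := by
    have : (t : ℝ≥0∞) < 1 := by
      rw [ht, ENNReal.div_lt_iff (Or.inl hC0) (Or.inl hCt), one_mul]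
      exact hRC
    exact_mod_cast this
  have h1 : ENNReal.ofReal R ≤ capacity m N (fun h => t * P h) (F.jam y) := by
    refine le_trans ?_ (mul_capacity_le hN hpos P (F.jam y) ht1.le)
    calc ENNReal.ofReal R = t * C := by rw [ht, ENNReal.div_mul_cancel hC0 hCt]
      _ ≤ t * capacity m N P (F.jam y) := mul_le_mul_right hC.le _
  have h2 := F.jam_secure y _ (hP.const_mul t) h1
  have h3 : meanPower m (fun h => t * P h) = t * meanPower m P := by
    simp only [meanPower, ENNReal.coe_mul]
    rw [lintegral_const_mul' _ _ ENNReal.coe_ne_top]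
  rw [h3] at h2
  have h4 : (F.level y : ℝ≥0∞) ≤ t * F.level y := h2.trans (mul_le_mul_right hle _)
  have h5 : F.level y ≤ t * F.level y := by exact_mod_cast h4
  have h6 : 0 < F.level y := F.level_zero_pos.trans_le (F.strictMono_level.monotone zero_le)
  have h7 : t * F.level y < 1 * F.level y := mul_lt_mul_of_pos_right ht1 h6
  rw [one_mul] at h7
  exact absurd h5 (not_le.2 h7)

/-- Jamming power less than `y` leaves `tx y` a rate above `R`: spending the rest uniformly over
the frame would still not bring the rate below `R`, and strictly lowers it. -/
lemma le_meanPower_of_capacity_tx_le (hN : 0 < N) (hR : 0 < R) (hpos : ∀ᵐ h ∂m, 0 < h)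
    [IsProbabilityMeasure m] {y : ℝ≥0} {J : ℝ → ℝ≥0} (hJ : Measurable J)
    (hle : capacity m N (F.tx y) J ≤ ENNReal.ofReal R) : (y : ℝ≥0∞) ≤ meanPower m J := by
  by_contra! hlt
  obtain ⟨j, hj⟩ : ∃ j : ℝ≥0, (j : ℝ≥0∞) = meanPower m J :=
    ⟨_, ENNReal.coe_toNNReal hlt.ne_top⟩
  rw [← hj] at hlt
  have hjy : j < y := by exact_mod_cast hlt
  set δ := y - j
  have hδ : 0 < δ := tsub_pos_of_lt hjy
  have hP : Measurable (F.tx y) := F.measurable_tx.comp measurable_prodMk_left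
  have h1 : meanPower m (fun h => J h + δ) ≤ y := by
    simp only [meanPower, ENNReal.coe_add]
    rw [lintegral_add_right _ measurable_const, lintegral_const, measure_univ, mul_one]
    change meanPower m J + δ ≤ y
    rw [← hj, ← ENNReal.coe_add, add_tsub_cancel_of_le hjy.le]
  have h2 := F.tx_secure y _ (hJ.add_const δ) h1
  have hmono : ∀ h, 0 < h → 1 + h * (F.tx y h : ℝ) / (N + ((J h + δ : ℝ≥0) : ℝ))
      ≤ 1 + h * (F.tx y h : ℝ) / (N + (J h : ℝ)) := by
    intro h hh
    push_cast
    have := δ.coe_nonneg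
    have : (0 : ℝ) < N + J h := by positivity
    gcongr
    linarith
  have hone : ∀ h, 0 < h → ∀ q : ℝ≥0, 1 ≤ 1 + h * (F.tx y h : ℝ) / (N + (q : ℝ)) := by
    intro h hh q
    have : 0 ≤ h * (F.tx y h : ℝ) / (N + (q : ℝ)) := by positivity
    linarith
  have h3 := ae_eq_of_ae_le_of_lintegral_le (μ := m)
    (f := fun h => ENNReal.ofReal (Real.log (1 + h * (F.tx y h : ℝ) /
      (N + ((J h + δ : ℝ≥0) : ℝ)))))
    (g := fun h => ENNReal.ofReal (Real.log (1 + h * (F.tx y h : ℝ) / (N + (J h : ℝ)))))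
    (by
      filter_upwards [hpos] with h hh
      exact ENNReal.ofReal_le_ofReal
        (Real.log_le_log (by linarith [hone h hh (J h + δ)]) (hmono h hh)))
    (ne_top_of_le_ne_top (ENNReal.ofReal_ne_top (r := R)) ((lintegral_mono_ae (by
      filter_upwards [hpos] with h hh
      exact ENNReal.ofReal_le_ofReal
        (Real.log_le_log (by linarith [hone h hh (J h + δ)]) (hmono h hh)))).trans hle))
    (measurable_rate hP hJ).ennreal_ofReal.aemeasurable (hle.trans h2)
  have h4 : capacity m N (F.tx y) J = 0 := by
    unfold capacity
    rw [lintegral_congr_ae (g := fun _ => 0)]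
    · simp
    filter_upwards [hpos, h3] with h hh he
    rw [ENNReal.ofReal_eq_ofReal_iff (Real.log_nonneg (hone h hh _))
      (Real.log_nonneg (hone h hh _))] at he
    have he2 := Real.log_injOn_pos
      (show _ ∈ Ioi (0 : ℝ) from lt_of_lt_of_le one_pos (hone h hh (J h + δ)))
      (show _ ∈ Ioi (0 : ℝ) from lt_of_lt_of_le one_pos (hone h hh (J h))) he
    have hδ' : (0 : ℝ) < δ := by exact_mod_cast hδ
    have hNJ : (0 : ℝ) < N + J h := by positivity
    have h5 : h * (F.tx y h : ℝ) = 0 := by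
      push_cast at he2
      rw [add_right_inj, div_eq_div_iff (by linarith) hNJ.ne'] at he2
      have : h * (F.tx y h : ℝ) * δ = 0 := by linear_combination -he2
      rcases mul_eq_zero.1 this with h6 | h6
      · exact h6
      · exact absurd h6 hδ'.ne'
    rw [h5]
    simp
  have h5 : capacity m N (F.tx y) (fun h => J h + δ) = 0 := by
    refine le_antisymm ?_ zero_le
    rw [← h4]
    refine lintegral_mono_ae ?_
    filter_upwards [h3] with h hh using hh.le
  rw [h5] at h2
  exact absurd h2 (not_le.2 (ENNReal.ofReal_pos.2 hR))

theorem requiredJx_level (hN : 0 < N) (hR : 0 < R) (hpos : ∀ᵐ h ∂m, 0 < h)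
    [IsProbabilityMeasure m] (y : ℝ≥0) : requiredJx m N R (F.level y) = y := by
  apply le_antisymm
  · refine iSup₂_le fun P hP => ?_
    exact (iInf₂_le (F.jam y) ⟨F.measurable_jam.comp measurable_prodMk_left,
      F.capacity_jam_le hN hpos hP.1 hP.2⟩).trans (F.mean_jam y).le
  · refine le_trans ?_ (le_iSup₂ (F.tx y)
      ⟨F.measurable_tx.comp measurable_prodMk_left, (F.mean_tx y).le⟩)
    exact le_iInf₂ fun J hJ => F.le_meanPower_of_capacity_tx_le hN hR hpos hJ.1 hJ.2

lemma requiredJx_mono : Monotone (requiredJx m N R) := by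
  intro q q' h
  refine iSup₂_le fun P hP => ?_
  exact le_iSup₂ (f := fun P (_ : P ∈ {P : ℝ → ℝ≥0 | Measurable P ∧ meanPower m P ≤ q'}) =>
    ⨅ J ∈ {J : ℝ → ℝ≥0 | Measurable J ∧ capacity m N P J ≤ ENNReal.ofReal R}, meanPower m J)
    P ⟨hP.1, hP.2.trans h⟩

end SaddleFamily

/-! ### The parameters of the equilibrium -/

section Parameters

variable {g : ℝ → ℝ}

lemma mul_le_integral_sub (hg : Continuous g) (hmono : StrictMonoOn g (Ici 0)) {u w : ℝ}
    (hu : 0 ≤ u) (huw : u ≤ w) :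
    g u * (w - u) ≤ (∫ y in (0 : ℝ)..w, g y) - ∫ y in (0 : ℝ)..u, g y := by
  rw [intervalIntegral.integral_interval_sub_left (hg.intervalIntegrable _ _)
    (hg.intervalIntegrable _ _)]
  have h1 := intervalIntegral.integral_mono_on huw (intervalIntegrable_const (μ := volume)
    (c := g u)) (hg.intervalIntegrable u w) fun x hx =>
      hmono.monotoneOn hu (hu.trans hx.1) hx.1
  rw [intervalIntegral.integral_const, smul_eq_mul] at h1
  linarith

lemma integral_sub_le_mul (hg : Continuous g) (hmono : StrictMonoOn g (Ici 0)) {u w : ℝ}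
    (hu : 0 ≤ u) (huw : u ≤ w) :
    (∫ y in (0 : ℝ)..w, g y) - ∫ y in (0 : ℝ)..u, g y ≤ g w * (w - u) := by
  rw [intervalIntegral.integral_interval_sub_left (hg.intervalIntegrable _ _)
    (hg.intervalIntegrable _ _)]
  have h1 := intervalIntegral.integral_mono_on huw (hg.intervalIntegrable u w)
    (intervalIntegrable_const (μ := volume) (c := g w)) fun x hx =>
      hmono.monotoneOn (hu.trans hx.1) (hu.trans huw) hx.2
  rw [intervalIntegral.integral_const, smul_eq_mul] at h1
  linarith

lemma integral_lt_mul (hg : Continuous g) (hmono : StrictMonoOn g (Ici 0)) {u : ℝ} (hu : 0 < u) :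
    ∫ y in (0 : ℝ)..u, g y < u * g u := by
  have h1 := integral_sub_le_mul hg hmono le_rfl (half_pos hu).le
  have h2 := integral_sub_le_mul hg hmono (half_pos hu).le (half_le_self hu.le)
  have h3 : g (u / 2) < g u := hmono (half_pos hu).le hu.le (half_lt_self hu)
  rw [intervalIntegral.integral_same] at h1
  nlinarith

lemma integral_pos_of_pos (hg : Continuous g) (hmono : StrictMonoOn g (Ici 0)) (hpos : 0 < g 0)
    {u : ℝ} (hu : 0 < u) : 0 < ∫ y in (0 : ℝ)..u, g y := by
  have h1 := mul_le_integral_sub hg hmono le_rfl hu.le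
  rw [intervalIntegral.integral_same] at h1
  nlinarith

lemma half_mul_le_integral (hg : Continuous g)
    (hconc : ∀ y w, 0 ≤ y → y ≤ w → y * g w ≤ w * g y) {u : ℝ} (hu : 0 < u) :
    u * g u / 2 ≤ ∫ y in (0 : ℝ)..u, g y := by
  have h1 := intervalIntegral.integral_mono_on (μ := volume) hu.le
    (f := fun y => y * (g u / u)) (g := g)
    (Continuous.intervalIntegrable (by fun_prop) _ _) (hg.intervalIntegrable _ _)
    fun y hy => by
      rw [← mul_div_assoc, div_le_iff₀ hu]
      linarith [hconc y u hy.1 hy.2]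
  refine le_trans (le_of_eq ?_) h1
  rw [intervalIntegral.integral_mul_const, integral_id]
  field_simp
  ring

lemma continuous_integral_zero (hg : Continuous g) :
    Continuous fun u => ∫ y in (0 : ℝ)..u, g y :=
  intervalIntegral.continuous_primitive (fun _ _ => hg.intervalIntegrable _ _) 0

lemma excess_lt_excess (hmono : StrictMonoOn g (Ici 0)) {a b u w : ℝ} (hu0 : 0 ≤ u) (ha : a < g u)
    (hb : b < u) (huw : u < w) : (g u - a) * (u - b) < (g w - a) * (w - b) := by
  have : g u < g w := hmono hu0 (hu0.trans huw.le) huw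
  nlinarith [mul_pos (sub_pos.2 ha) (sub_pos.2 huw), mul_pos (sub_pos.2 this) (sub_pos.2 hb),
    mul_pos (sub_pos.2 this) (sub_pos.2 huw)]

lemma lt_of_excess_eq (hmono : StrictMonoOn g (Ici 0)) (hpos : 0 < g 0) {a b u : ℝ} (ha : 0 < a)
    (hb : 0 < b) (hu : 0 ≤ u) (h : a * b = (g u - a) * (u - b)) : a < g u ∧ b < u := by
  have h0 : 0 < g u := hpos.trans_le (hmono.monotoneOn (self_mem_Ici) hu hu)
  have hab := mul_pos ha hb
  rcases lt_or_ge b u with h1 | h1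
  · refine ⟨?_, h1⟩
    by_contra! h2
    nlinarith
  · exfalso
    rcases lt_or_ge a (g u) with h2 | h2
    · nlinarith
    · nlinarith [mul_nonneg (sub_nonneg.2 h2) hu]

/-- The function whose zero determines `v` in the third case is strictly decreasing beyond `b`. -/
lemma loss_lt_loss (hg : Continuous g) (hmono : StrictMonoOn g (Ici 0)) {b u w : ℝ}
    (hb : 0 < b) (hu : b < u) (huw : u < w) :
    (∫ y in (0 : ℝ)..w, g y) - g w * (w - b) < (∫ y in (0 : ℝ)..u, g y) - g u * (u - b) := by
  have h0 : 0 ≤ u := by linarith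
  have h1 := integral_sub_le_mul hg hmono h0 huw.le
  have h2 : g u < g w := hmono h0 (h0.trans huw.le) huw
  nlinarith [mul_pos (sub_pos.2 h2) (sub_pos.2 hu)]

lemma exists_unique_threshold (hg : Continuous g) (hmono : StrictMonoOn g (Ici 0)) (hpos : 0 < g 0)
    (hub : ∀ x, ∃ y, 0 ≤ y ∧ x ≤ g y) {a b : ℝ} (ha : 0 < a) (hb : 0 < b) :
    ∃ v₀, IsUniqueSolution (Ici 0) (fun w => a * b = (g (2 * w) - a) * (2 * w - b)) v₀ := by
  obtain ⟨y, hy0, hy⟩ := hub (2 * a)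
  have hy' : g y ≤ g (max y (2 * b)) :=
    hmono.monotoneOn hy0 (hy0.trans (le_max_left _ _)) (le_max_left _ _)
  have h2 : 2 * b ≤ max y (2 * b) := le_max_right _ _
  obtain ⟨u, hu, hue⟩ := intermediate_value_Icc (show b ≤ max y (2 * b) by linarith)
    (f := fun u => (g u - a) * (u - b)) (by fun_prop)
    (show a * b ∈ Icc _ _ from ⟨by simp; positivity, by nlinarith⟩)
  have e : 2 * (u / 2) = u := by ring
  have hu0 : 0 ≤ u := hb.le.trans hu.1
  obtain ⟨hu1, hu2⟩ := lt_of_excess_eq hmono hpos ha hb hu0 hue.symm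
  refine ⟨u / 2, by simp only [mem_Ici]; linarith, by simp only [e]; exact hue.symm, ?_⟩
  intro w hw hwe
  have hw0 : 0 ≤ 2 * w := by simp only [mem_Ici] at hw; linarith
  obtain ⟨hw1, hw2⟩ := lt_of_excess_eq hmono hpos ha hb hw0 hwe
  rcases lt_trichotomy (2 * w) u with h | h | h
  · have := excess_lt_excess hmono hw0 hw1 hw2 h
    simp only at hue
    linarith
  · linarith
  · have := excess_lt_excess hmono hu0 hu1 hu2 h
    simp only at hue
    linarith

/-- If the area under the curve falls short of `2 v₀ a` at `v₀`, there is one later point where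
the two are equal. -/
lemma exists_unique_balance (hg : Continuous g) (hmono : StrictMonoOn g (Ici 0)) (hpos : 0 < g 0)
    (hub : ∀ x, ∃ y, 0 ≤ y ∧ x ≤ g y) {a v₀ : ℝ} (hv₀ : 0 ≤ v₀)
    (hS : sFun g a v₀ < 0) :
    ∃ v, v₀ < v ∧
      IsUniqueSolution (Ioi 0) (fun w => (∫ y in (0 : ℝ)..(2 * w), g y) - 2 * w * a = 0) v := by
  -- beyond `x` the curve exceeds `2 a`, so at `2 x` the area has caught up
  obtain ⟨y, hy0, hy⟩ := hub (2 * a)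
  set x := max y (2 * v₀)
  have hx0 : 0 ≤ x := hy0.trans (le_max_left _ _)
  have hxg : 2 * a ≤ g x := hy.trans (hmono.monotoneOn hy0 hx0 (le_max_left _ _))
  have hxv : 2 * v₀ ≤ x := le_max_right _ _
  unfold sFun at hS
  have h1 := mul_le_integral_sub hg hmono hx0 (show x ≤ 2 * x by linarith)
  have h2 := mul_le_integral_sub hg hmono le_rfl hx0
  rw [intervalIntegral.integral_same] at h2
  have hcI := continuous_integral_zero hg
  obtain ⟨u, hu, hue⟩ := intermediate_value_Icc (show 2 * v₀ ≤ 2 * x by linarith)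
    (f := fun u => (∫ y in (0 : ℝ)..u, g y) - u * a)
    (hcI.sub (continuous_id.mul continuous_const)).continuousOn
    (show (0 : ℝ) ∈ Icc _ _ from ⟨by linarith, by nlinarith⟩)
  simp only at hue
  have hne : 2 * v₀ ≠ u := by
    rintro rfl
    linarith
  have hlt : 2 * v₀ < u := lt_of_le_of_ne hu.1 hne
  have key : ∀ p q : ℝ, 0 < p → p < q → (∫ y in (0 : ℝ)..p, g y) - p * a = 0 →
      (∫ y in (0 : ℝ)..q, g y) - q * a = 0 → False := by
    intro p q hp hpq h3 h4
    have h5 := integral_lt_mul hg hmono hp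
    have h6 := mul_le_integral_sub hg hmono hp.le hpq.le
    have h7 : a < g p := by nlinarith
    nlinarith [mul_pos (sub_pos.2 h7) (sub_pos.2 hpq)]
  have e : 2 * (u / 2) = u := by ring
  refine ⟨u / 2, by linarith, by simp only [mem_Ioi]; linarith, by simp only [e]; exact hue, ?_⟩
  intro w hw hwe
  simp only [mem_Ioi] at hw
  rcases lt_trichotomy (2 * w) u with h | h | h
  · exact (key _ _ (by linarith) h hwe hue).elim
  · linarith
  · exact (key _ _ (by linarith) h hue hwe).elim

lemma exists_unique_loss_eq_zero (hg : Continuous g) (hmono : StrictMonoOn g (Ici 0))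
    (hpos : 0 < g 0) (hub : ∀ x, ∃ y, 0 ≤ y ∧ x ≤ g y) {b v₀ : ℝ} (hb : 0 < b) (hv₀ : 0 ≤ v₀)
    (hS : 0 < (∫ y in (0 : ℝ)..(2 * v₀), g y) - g (2 * v₀) * (2 * v₀ - b)) :
    ∃ v, v₀ < v ∧ IsUniqueSolution (Ioi 0)
      (fun w => (∫ y in (0 : ℝ)..(2 * w), g y) - g (2 * w) * (2 * w - b) = 0) v := by
  -- the loss is at most `2 b * g (2 b) - b * g x`, hence nonpositive once `g x ≥ 2 * g (2 b)`
  obtain ⟨y, hy0, hy⟩ := hub (2 * g (2 * b))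
  set x := max (max y (2 * b)) (2 * v₀)
  have hyx : y ≤ x := (le_max_left _ _).trans (le_max_left _ _)
  have hbx : 2 * b ≤ x := (le_max_right _ _).trans (le_max_left _ _)
  have hvx : 2 * v₀ ≤ x := le_max_right _ _
  have hx0 : 0 ≤ x := hy0.trans hyx
  have hxg : 2 * g (2 * b) ≤ g x := hy.trans (hmono.monotoneOn hy0 hx0 hyx)
  have h1 := integral_sub_le_mul hg hmono (show 0 ≤ 2 * b by linarith) hbx
  have h2 := integral_sub_le_mul hg hmono le_rfl (show 0 ≤ 2 * b by linarith)
  rw [intervalIntegral.integral_same] at h2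
  have hcI := continuous_integral_zero hg
  obtain ⟨u, hu, hue⟩ := intermediate_value_Icc' hvx
    (f := fun u => (∫ y in (0 : ℝ)..u, g y) - g u * (u - b))
    (hcI.sub (hg.mul (continuous_id.sub continuous_const))).continuousOn
    (show (0 : ℝ) ∈ Icc _ _ from ⟨by nlinarith, hS.le⟩)
  simp only at hue
  have hne : 2 * v₀ ≠ u := by
    rintro rfl
    linarith
  have hlt : 2 * v₀ < u := lt_of_le_of_ne hu.1 hne
  have hgt : ∀ p : ℝ, 0 < p → (∫ y in (0 : ℝ)..p, g y) - g p * (p - b) = 0 → b < p := by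
    intro p hp h3
    by_contra! h4
    have h5 := integral_pos_of_pos hg hmono hpos hp
    have h6 : 0 < g p := hpos.trans_le (hmono.monotoneOn self_mem_Ici hp.le hp.le)
    nlinarith [mul_nonneg h6.le (sub_nonneg.2 h4)]
  have e : 2 * (u / 2) = u := by ring
  refine ⟨u / 2, by linarith, by simp only [mem_Ioi]; linarith, by simp only [e]; exact hue, ?_⟩
  intro w hw hwe
  simp only [mem_Ioi] at hw
  rcases lt_trichotomy (2 * w) u with h | h | h
  · have := loss_lt_loss hg hmono hb (hgt _ (by linarith) hwe) h
    linarith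
  · linarith
  · have := loss_lt_loss hg hmono hb (hgt _ (by linarith) hue) h
    linarith

/-- What the case procedure gives, in the form in which the game uses it. The two identities for
the areas say that both players spend their whole power budget, the last identity that both laws
guarantee the same outage probability. -/
structure IsEquilibriumParameter (g : ℝ → ℝ) (a b v kp kj : ℝ) : Prop where
  v_pos : 0 < v
  b_le : b ≤ v
  a_lt : a < g (2 * v)
  kp_pos : 0 < kp
  kp_le : kp ≤ 1
  kj_pos : 0 < kj
  kj_le : kj ≤ 1
  tx_budget : kp * (∫ y in (0 : ℝ)..(2 * v), g y) = 2 * v * a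
  jam_budget : kj * (2 * v * g (2 * v) - ∫ y in (0 : ℝ)..(2 * v), g y) = b * g (2 * v)
  value_eq : 1 - kp + kp * (b / (2 * v)) = kj * (1 - a / g (2 * v))

theorem exists_parameters (hg : Continuous g) (hmono : StrictMonoOn g (Ici 0)) (hpos : 0 < g 0)
    (hub : ∀ x, ∃ y, 0 ≤ y ∧ x ≤ g y) (hconc : ∀ y w, 0 ≤ y → y ≤ w → y * g w ≤ w * g y)
    {a b : ℝ} (ha : 0 < a) (hb : 0 < b) :
    ∃ v₀ v kp kj, CaseProcedure g a b v₀ v kp kj ∧ IsEquilibriumParameter g a b v kp kj := by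
  obtain ⟨v₀, hv₀⟩ := exists_unique_threshold hg hmono hpos hub ha hb
  have hv₀0 : 0 ≤ v₀ := hv₀.1
  have hv₀e : a * b = (g (2 * v₀) - a) * (2 * v₀ - b) := hv₀.2.1
  obtain ⟨hga, hbv⟩ := lt_of_excess_eq hmono hpos ha hb (by linarith) hv₀e
  -- the inequality that makes `kp` and `kj` at most `1` persists beyond `v₀`
  have hlater : ∀ v, v₀ ≤ v → a < g (2 * v) ∧ b < 2 * v ∧
      a * b ≤ (g (2 * v) - a) * (2 * v - b) := by
    intro v hv
    rcases hv.eq_or_lt with rfl | hlt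
    · exact ⟨hga, hbv, hv₀e.le⟩
    · exact ⟨hga.trans_le (hmono.monotoneOn (by simp only [mem_Ici]; linarith)
        (by simp only [mem_Ici]; linarith) (by linarith)), by linarith,
        hv₀e.le.trans (excess_lt_excess hmono (by linarith) hga hbv (by linarith)).le⟩
  -- the curve lies above its chord from the origin, so the jammer's budget is at most `v`
  have hble : ∀ v kj, 0 < v → 0 < g (2 * v) → 0 < kj → kj ≤ 1 →
      kj * (2 * v * g (2 * v) - ∫ y in (0 : ℝ)..(2 * v), g y) = b * g (2 * v) → b ≤ v := by
    intro v kj hv hgv hk hk1 he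
    have h1 := half_mul_le_integral hg hconc (show 0 < 2 * v by linarith)
    have h2 := integral_lt_mul hg hmono (show 0 < 2 * v by linarith)
    have h3 : b * g (2 * v) ≤ v * g (2 * v) := by
      rw [← he]
      nlinarith [mul_nonneg (sub_nonneg.2 hk1) (sub_nonneg.2 h2.le)]
    exact le_of_mul_le_mul_right h3 hgv
  rcases lt_trichotomy (sFun g a v₀) 0 with hS | hS | hS
  · obtain ⟨v, hv, hvs⟩ := exists_unique_balance hg hmono hpos hub hv₀0 hS
    obtain ⟨h1, h2, h3⟩ := hlater v hv.le
    have hv0 : 0 < v := hvs.1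
    have hI : (∫ y in (0 : ℝ)..(2 * v), g y) - 2 * v * a = 0 := hvs.2.1
    have hg0 : 0 < g (2 * v) := ha.trans h1
    have hga' : 0 < g (2 * v) - a := sub_pos.2 h1
    have hk0 : 0 < b * g (2 * v) / (2 * v * (g (2 * v) - a)) := by positivity
    have hk1 : b * g (2 * v) / (2 * v * (g (2 * v) - a)) ≤ 1 := by
      rw [div_le_one (by positivity)]
      nlinarith
    have hE2 : b * g (2 * v) / (2 * v * (g (2 * v) - a)) *
        (2 * v * g (2 * v) - ∫ y in (0 : ℝ)..(2 * v), g y) = b * g (2 * v) := by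
      rw [show (∫ y in (0 : ℝ)..(2 * v), g y) = 2 * v * a by linarith,
        show 2 * v * g (2 * v) - 2 * v * a = 2 * v * (g (2 * v) - a) by ring]
      field_simp
    refine ⟨v₀, v, 1, b * g (2 * v) / (2 * v * (g (2 * v) - a)),
      ⟨hv₀, fun _ => ⟨hvs, rfl, rfl⟩, fun h => absurd h hS.ne, fun h => absurd h hS.not_gt⟩,
      ⟨hv0, hble v _ hv0 hg0 hk0 hk1 hE2, h1, one_pos, le_rfl, hk0, hk1, by linarith, hE2, ?_⟩⟩
    field_simp
    ring
  · have hv0 : 0 < v₀ := by linarith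
    have hg0 : 0 < g (2 * v₀) := ha.trans hga
    have hI : (∫ y in (0 : ℝ)..(2 * v₀), g y) - 2 * v₀ * a = 0 := hS
    have hE2 : 1 * (2 * v₀ * g (2 * v₀) - ∫ y in (0 : ℝ)..(2 * v₀), g y) = b * g (2 * v₀) := by
      linarith
    refine ⟨v₀, v₀, 1, 1,
      ⟨hv₀, fun h => absurd hS h.ne, fun _ => ⟨rfl, rfl, rfl⟩, fun h => absurd hS h.ne'⟩,
      ⟨hv0, hble v₀ _ hv0 hg0 one_pos le_rfl hE2, hga, one_pos, le_rfl, one_pos, le_rfl,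
        by linarith, hE2, ?_⟩⟩
    field_simp
    linarith
  · have hS' : 0 < (∫ y in (0 : ℝ)..(2 * v₀), g y) - g (2 * v₀) * (2 * v₀ - b) := by
      unfold sFun at hS
      linarith
    obtain ⟨v, hv, hvs⟩ := exists_unique_loss_eq_zero hg hmono hpos hub hb hv₀0 hS'
    obtain ⟨h1, h2, h3⟩ := hlater v hv.le
    have hv0 : 0 < v := hvs.1
    have hI : (∫ y in (0 : ℝ)..(2 * v), g y) - g (2 * v) * (2 * v - b) = 0 := hvs.2.1
    have hg0 : 0 < g (2 * v) := ha.trans h1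
    have hb' : 0 < 2 * v - b := sub_pos.2 h2
    have hk0 : 0 < 2 * v * a / (g (2 * v) * (2 * v - b)) := by positivity
    have hE2 : 1 * (2 * v * g (2 * v) - ∫ y in (0 : ℝ)..(2 * v), g y) = b * g (2 * v) := by
      linarith
    refine ⟨v₀, v, 2 * v * a / (g (2 * v) * (2 * v - b)), 1,
      ⟨hv₀, fun h => absurd hS h.not_gt, fun h => absurd hS h.not_gt, fun _ => ⟨hvs, rfl, rfl⟩⟩,
      ⟨hv0, hble v _ hv0 hg0 one_pos le_rfl hE2, h1, hk0, ?_, one_pos, le_rfl, ?_, hE2, ?_⟩⟩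
    · rw [div_le_one (by positivity)]
      nlinarith
    · rw [show (∫ y in (0 : ℝ)..(2 * v), g y) = g (2 * v) * (2 * v - b) by linarith]
      field_simp
    · field_simp
      ring

end Parameters

/-! ### The game between frames: affine bounds and complementary slackness -/

section FrameGame

/-- Outage probability against jamming power `y` when the transmitter's power has law `μ` and the
power needed against `y` is `g y`. -/
noncomputable def txLoss (g : ℝ≥0 → ℝ≥0) (μ : Measure ℝ≥0) (y : ℝ≥0) : ℝ :=
  μ.real {x | x < g y}

/-- Probability that transmitter power `x` avoids outage when the jammer's power has law `ν`. -/
noncomputable def txGain (g : ℝ≥0 → ℝ≥0) (ν : Measure ℝ≥0) (x : ℝ≥0) : ℝ :=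
  ν.real {y | g y ≤ x}

/-- Outage probability of the game between frames when the required power is `g`. -/
noncomputable def loss (g : ℝ≥0 → ℝ≥0) (μ ν : Measure ℝ≥0) : ℝ :=
  (μ.prod ν).real {z | z.1 < g z.2}

variable {g : ℝ≥0 → ℝ≥0} {μ ν : Measure ℝ≥0} {a b c V s : ℝ}

lemma integrable_coe_of_mem (h : μ ∈ averageLaws a) : Integrable (fun x : ℝ≥0 => (x : ℝ)) μ := by
  refine ⟨NNReal.continuous_coe.measurable.aestronglyMeasurable, ?_⟩
  refine lt_of_le_of_lt (le_of_eq ?_) (h.2.trans_lt ENNReal.ofReal_lt_top)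
  refine lintegral_congr fun x => ?_
  simp [enorm_eq_nnnorm]

lemma integral_coe_le_of_mem (ha : 0 ≤ a) (h : μ ∈ averageLaws a) :
    ∫ x : ℝ≥0, (x : ℝ) ∂μ ≤ a := by
  rw [integral_eq_lintegral_of_nonneg_ae (Filter.Eventually.of_forall fun x => x.coe_nonneg)
    NNReal.continuous_coe.measurable.aestronglyMeasurable]
  refine ENNReal.toReal_le_of_le_ofReal ha ?_
  simpa using h.2

lemma measurableSet_loss (hg : Measurable g) : MeasurableSet {z : ℝ≥0 × ℝ≥0 | z.1 < g z.2} :=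
  measurableSet_lt measurable_fst (hg.comp measurable_snd)

lemma txLoss_nonneg (y : ℝ≥0) : 0 ≤ txLoss g μ y := measureReal_nonneg

lemma txLoss_le_one [IsProbabilityMeasure μ] (y : ℝ≥0) : txLoss g μ y ≤ 1 := measureReal_le_one

lemma txGain_nonneg (x : ℝ≥0) : 0 ≤ txGain g ν x := measureReal_nonneg

lemma txGain_le_one [IsProbabilityMeasure ν] (x : ℝ≥0) : txGain g ν x ≤ 1 := measureReal_le_one

lemma monotone_txLoss [IsProbabilityMeasure μ] (hg : Monotone g) : Monotone (txLoss g μ) :=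
  fun _ _ h => measureReal_mono fun _ hx => lt_of_lt_of_le hx (hg h)

lemma monotone_txGain [IsProbabilityMeasure ν] : Monotone (txGain g ν) :=
  fun _ _ h => measureReal_mono fun _ hy => le_trans hy h

lemma loss_eq_integral_txLoss (hg : Measurable g) [IsProbabilityMeasure μ]
    [IsProbabilityMeasure ν] : loss g μ ν = ∫ y, txLoss g μ y ∂ν := by
  have hm := measurableSet_loss hg
  unfold loss txLoss Measure.real
  rw [Measure.prod_apply_symm hm, integral_toReal]
  · rfl
  · exact (measurable_measure_prodMk_right hm).aemeasurable
  · exact Filter.Eventually.of_forall fun y => measure_lt_top _ _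

lemma one_sub_loss_eq_integral_txGain (hg : Measurable g) [IsProbabilityMeasure μ]
    [IsProbabilityMeasure ν] : 1 - loss g μ ν = ∫ x, txGain g ν x ∂μ := by
  have hm := (measurableSet_loss hg).compl
  unfold loss txGain
  rw [← probReal_compl_eq_one_sub (measurableSet_loss hg)]
  unfold Measure.real
  rw [Measure.prod_apply hm, ← integral_toReal]
  · refine integral_congr_ae (Filter.Eventually.of_forall fun x => ?_)
    simp only [preimage_ofPred_eq, compl_ofPred, not_lt]
  · exact (measurable_measure_prodMk_left hm).aemeasurable
  · exact Filter.Eventually.of_forall fun y => measure_lt_top _ _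

/-- A function whose mean under every law of mean at most `c` is at most `V` lies below a line of
nonnegative slope through `(c, V)`: laws supported on two points suffice. -/
lemma exists_supporting_line {f : ℝ≥0 → ℝ} (hc : 0 < c)
    (hf : ∀ ν ∈ averageLaws c, ∫ y, f y ∂ν ≤ V) :
    ∃ s, 0 ≤ s ∧ ∀ y : ℝ≥0, f y ≤ V + s * ((y : ℝ) - c) := by
  have h1 : ∀ y : ℝ≥0, (y : ℝ) ≤ c → f y ≤ V := by
    intro y hy
    have := hf (Measure.dirac y) ⟨inferInstance, by
      rw [lintegral_dirac, ← ENNReal.ofReal_coe_nnreal]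
      exact ENNReal.ofReal_le_ofReal hy⟩
    rwa [integral_dirac] at this
  have h2 : ∀ y z : ℝ≥0, (y : ℝ) < c → c < z →
      (f z - V) / ((z : ℝ) - c) ≤ (V - f y) / (c - y) := by
    intro y z hy hz
    have hyz : (0 : ℝ) < z - y := by linarith
    have hw0 : 0 ≤ ((z : ℝ) - c) / (z - y) := div_nonneg (by linarith) hyz.le
    have hw1 : 0 ≤ (c - (y : ℝ)) / (z - y) := div_nonneg (by linarith) hyz.le
    have hsum : ((z : ℝ) - c) / (z - y) + (c - (y : ℝ)) / (z - y) = 1 := by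
      field_simp
      ring
    have h3 := hf (ENNReal.ofReal (((z : ℝ) - c) / (z - y)) • Measure.dirac y
      + ENNReal.ofReal ((c - (y : ℝ)) / (z - y)) • Measure.dirac z) (by
        constructor
        · constructor
          simp only [Measure.coe_add, Measure.coe_smul, Pi.add_apply, Pi.smul_apply, measure_univ,
            smul_eq_mul, mul_one]
          rw [← ENNReal.ofReal_add hw0 hw1, hsum, ENNReal.ofReal_one]
        · rw [lintegral_add_measure, lintegral_smul_measure, lintegral_smul_measure,
            lintegral_dirac, lintegral_dirac, smul_eq_mul, smul_eq_mul,
            ← ENNReal.ofReal_coe_nnreal, ← ENNReal.ofReal_coe_nnreal (p := z),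
            ← ENNReal.ofReal_mul hw0, ← ENNReal.ofReal_mul hw1,
            ← ENNReal.ofReal_add (mul_nonneg hw0 y.coe_nonneg) (mul_nonneg hw1 z.coe_nonneg)]
          apply ENNReal.ofReal_le_ofReal
          apply le_of_eq
          field_simp
          ring)
    have hint : ∀ x : ℝ≥0, Integrable f (Measure.dirac x) := fun x =>
      integrable_dirac (by simp)
    rw [integral_add_measure ((hint y).smul_measure ENNReal.ofReal_ne_top)
      ((hint z).smul_measure ENNReal.ofReal_ne_top), integral_smul_measure, integral_smul_measure,
      integral_dirac, integral_dirac, ENNReal.toReal_ofReal hw0, ENNReal.toReal_ofReal hw1,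
      smul_eq_mul, smul_eq_mul, div_mul_eq_mul_div, div_mul_eq_mul_div, ← add_div,
      div_le_iff₀ hyz] at h3
    rw [div_le_div_iff₀ (by linarith) (by linarith)]
    nlinarith
  -- the slope is the steepest ascent from `(c, V)` to the right
  set B : Set ℝ := insert 0 ((fun z : ℝ≥0 => (f z - V) / ((z : ℝ) - c)) '' {z : ℝ≥0 | c < z})
  have hBub : ∀ y : ℝ≥0, (y : ℝ) < c → ∀ t ∈ B, t ≤ (V - f y) / (c - y) := by
    rintro y hy t (rfl | ⟨z, hz, rfl⟩)
    · exact div_nonneg (by linarith [h1 y hy.le]) (by linarith)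
    · exact h2 y z hy hz
  have hbdd : BddAbove B := ⟨_, fun t ht => hBub 0 (by simpa using hc) t ht⟩
  refine ⟨sSup B, le_csSup hbdd (mem_insert _ _), fun y => ?_⟩
  rcases lt_trichotomy (y : ℝ) c with hy | hy | hy
  · have h3 := csSup_le ⟨0, mem_insert _ _⟩ (hBub y hy)
    rw [le_div_iff₀ (by linarith)] at h3
    linarith
  · rw [hy, sub_self, mul_zero, add_zero]
    exact h1 y hy.le
  · have h3 : (f y - V) / ((y : ℝ) - c) ≤ sSup B :=
      le_csSup hbdd (mem_insert_of_mem _ ⟨y, hy, rfl⟩)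
    rw [div_le_iff₀ (by linarith)] at h3
    linarith

lemma integral_le_of_le_line {f : ℝ≥0 → ℝ} (hc : 0 ≤ c) (hs : 0 ≤ s)
    (hfi : Integrable f ν) (hν : ν ∈ averageLaws c)
    (hle : ∀ y : ℝ≥0, f y ≤ V + s * ((y : ℝ) - c)) : ∫ y, f y ∂ν ≤ V := by
  have := hν.1
  have hi := integrable_coe_of_mem hν
  have hsub : Integrable (fun y : ℝ≥0 => s * ((y : ℝ) - c)) ν :=
    (hi.sub (integrable_const c)).const_mul s
  have h1 : ∫ y : ℝ≥0, (V + s * ((y : ℝ) - c)) ∂ν = V + s * (∫ y : ℝ≥0, (y : ℝ) ∂ν - c) := by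
    rw [integral_add (integrable_const _) hsub, integral_const_mul,
      integral_sub hi (integrable_const c)]
    simp
  have h2 := integral_mono hfi ((integrable_const V).add hsub) hle
  have h3 := integral_coe_le_of_mem hc hν
  have h4 : ∫ y, f y ∂ν ≤ V + s * (∫ y : ℝ≥0, (y : ℝ) ∂ν - c) := h1 ▸ h2
  nlinarith

/-- Complementary slackness. -/
lemma ae_eq_line {f : ℝ≥0 → ℝ} (hc : 0 ≤ c) (hs : 0 ≤ s)
    (hfi : Integrable f ν) (hν : ν ∈ averageLaws c)
    (hle : ∀ y : ℝ≥0, f y ≤ V + s * ((y : ℝ) - c)) (hV : V ≤ ∫ y, f y ∂ν) :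
    ∀ᵐ y ∂ν, f y = V + s * ((y : ℝ) - c) := by
  have := hν.1
  have hi := integrable_coe_of_mem hν
  have hli : Integrable (fun y : ℝ≥0 => V + s * ((y : ℝ) - c)) ν :=
    (integrable_const V).add ((hi.sub (integrable_const c)).const_mul s)
  refine (integral_eq_iff_of_ae_le hfi hli (Filter.Eventually.of_forall hle)).1 ?_
  refine le_antisymm (integral_mono hfi hli hle) (le_trans ?_ hV)
  exact integral_le_of_le_line hc hs hli hν fun _ => le_rfl

lemma integrable_txLoss (hg : Monotone g) [IsProbabilityMeasure μ] [IsProbabilityMeasure ν] :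
    Integrable (txLoss g μ) ν :=
  Integrable.mono' (integrable_const 1) (monotone_txLoss hg).measurable.aestronglyMeasurable
    (Filter.Eventually.of_forall fun y => by
      rw [Real.norm_of_nonneg (txLoss_nonneg y)]
      exact txLoss_le_one y)

lemma integrable_txGain [IsProbabilityMeasure μ] [IsProbabilityMeasure ν] :
    Integrable (txGain g ν) μ :=
  Integrable.mono' (integrable_const 1) monotone_txGain.measurable.aestronglyMeasurable
    (Filter.Eventually.of_forall fun y => by
      rw [Real.norm_of_nonneg (txGain_nonneg y)]
      exact txGain_le_one y)

lemma le_of_forall_lt_le {k : ℝ≥0 → ℝ} (hk : Continuous k) {y : ℝ≥0} (hy : 0 < y) {C : ℝ}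
    (h : ∀ z < y, k z ≤ C) : k y ≤ C := by
  have : (nhdsWithin y (Iio y)).NeBot := nhdsLT_neBot_of_exists_lt ⟨0, hy⟩
  exact le_of_tendsto (hk.continuousWithinAt (s := Iio y)).tendsto
    (Filter.eventually_of_mem self_mem_nhdsWithin h)

lemma le_of_forall_gt_le {k : ℝ≥0 → ℝ} (hk : Continuous k) {y : ℝ≥0} {C : ℝ}
    (h : ∀ z > y, C ≤ k z) : C ≤ k y := by
  exact ge_of_tendsto (hk.continuousWithinAt (s := Ioi y)).tendsto
    (Filter.eventually_of_mem self_mem_nhdsWithin h)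

/-- A property that holds `ν`-almost everywhere holds somewhere in an interval that `ν` charges. -/
lemma exists_mem_Ioc_of_ae {p : ℝ≥0 → Prop} [IsProbabilityMeasure ν] (hp : ∀ᵐ y ∂ν, p y)
    {y z : ℝ≥0} (hyz : y ≤ z) (h : ν.real (Iic y) < ν.real (Iic z)) : ∃ x ∈ Ioc y z, p x := by
  have h1 : ν.real (Ioc y z) ≠ 0 := by
    rw [show Ioc y z = Iic z \ Iic y by ext; simp [and_comm],
      measureReal_sdiff (Iic_subset_Iic.2 hyz) measurableSet_Iic]
    linarith
  have h2 : ν (Ioc y z) ≠ 0 := fun h0 => h1 (by simp [Measure.real, h0])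
  obtain ⟨x, hx, hpx⟩ := (frequently_ae_mem_iff.2 h2).and_eventually hp |>.exists
  exact ⟨x, hx, hpx⟩

lemma ext_of_Iic_pos [IsProbabilityMeasure μ] [IsProbabilityMeasure ν]
    (h : ∀ y, 0 < y → μ (Iic y) = ν (Iic y)) : μ = ν := by
  refine Measure.ext_of_Iic _ _ fun y => ?_
  -- right-continuity of the distribution function extends the equality to `0`
  have hlim : ∀ (ρ : Measure ℝ≥0) [IsProbabilityMeasure ρ], Filter.Tendsto
      (fun n : ℕ => ρ (Iic (y + 1 / ((n : ℝ≥0) + 1)))) Filter.atTop (nhds (ρ (Iic y))) := by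
    intro ρ _
    have h1 : ⋂ n : ℕ, Iic (y + 1 / ((n : ℝ≥0) + 1)) = Iic y := by
      ext x
      simp only [mem_iInter, mem_Iic]
      refine ⟨fun hx => ?_, fun hx n => hx.trans le_self_add⟩
      by_contra! hlt
      obtain ⟨n, hn⟩ := exists_nat_one_div_lt (show (0 : ℝ) < x - y by
        have : (y : ℝ) < x := by exact_mod_cast hlt
        linarith)
      have h2 : (x : ℝ) ≤ y + 1 / ((n : ℝ) + 1) := by exact_mod_cast hx n
      linarith
    rw [← h1]
    refine tendsto_measure_iInter_atTop (fun n => measurableSet_Iic.nullMeasurableSet) ?_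
      ⟨0, measure_ne_top _ _⟩
    intro i j hij
    refine Iic_subset_Iic.2 (add_le_add_right ?_ _)
    have : (i : ℝ≥0) ≤ j := by exact_mod_cast hij
    exact one_div_le_one_div_of_le (by positivity) (by gcongr)
  refine tendsto_nhds_unique (hlim μ) ((hlim ν).congr fun n => ?_)
  exact (h _ (by positivity)).symm

end FrameGame

/-! ### The equilibrium laws of the game between frames -/

section EquilibriumLaws

/-- The law that is `0` with probability `1 - k` and otherwise `f` of a uniform variable on
`[0, 1]`. -/
noncomputable def mixLaw (k : ℝ) (f : ℝ → ℝ≥0) : Measure ℝ≥0 :=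
  ENNReal.ofReal k • (volume.restrict (Icc (0 : ℝ) 1)).map f
    + ENNReal.ofReal (1 - k) • Measure.dirac 0

/-- The transmitter's law `F_P`: the required power against a uniform jamming power on `[0, 2v]`,
used with probability `kp`. -/
noncomputable def txLaw (g : ℝ≥0 → ℝ≥0) (kp v : ℝ) : Measure ℝ≥0 :=
  mixLaw kp fun t => g (2 * v * t).toNNReal

/-- The jammer's law `F_J`: the jamming power that spoils a uniform transmitter power on `[0, G]`,
used with probability `kj`. -/
noncomputable def jamLaw (ginv : ℝ≥0 → ℝ≥0) (kj G : ℝ) : Measure ℝ≥0 :=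
  mixLaw kj fun t => ginv (G * t).toNNReal

lemma mixLaw_real_apply {k : ℝ} (hk0 : 0 ≤ k) (hk1 : k ≤ 1) {f : ℝ → ℝ≥0} (hf : Measurable f)
    {A : Set ℝ≥0} (hA : MeasurableSet A) :
    (mixLaw k f).real A
      = k * volume.real (f ⁻¹' A ∩ Icc 0 1) + (1 - k) * A.indicator (fun _ => (1 : ℝ)) 0 := by
  have h1 : volume (f ⁻¹' A ∩ Icc (0 : ℝ) 1) ≠ ∞ :=
    ((measure_mono inter_subset_right).trans_lt (by simp)).ne
  unfold mixLaw Measure.real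
  rw [Measure.add_apply, Measure.smul_apply, Measure.smul_apply, Measure.map_apply hf hA,
    Measure.restrict_apply (hf hA), Measure.dirac_apply' _ hA, smul_eq_mul, smul_eq_mul,
    ENNReal.toReal_add (ENNReal.mul_ne_top ENNReal.ofReal_ne_top h1)
      (ENNReal.mul_ne_top ENNReal.ofReal_ne_top (by by_cases h : (0 : ℝ≥0) ∈ A <;> simp [h])),
    ENNReal.toReal_mul, ENNReal.toReal_mul, ENNReal.toReal_ofReal hk0,
    ENNReal.toReal_ofReal (by linarith)]
  by_cases h : (0 : ℝ≥0) ∈ A <;> simp [h]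

lemma isProbabilityMeasure_mixLaw {k : ℝ} (hk0 : 0 ≤ k) (hk1 : k ≤ 1) {f : ℝ → ℝ≥0}
    (hf : Measurable f) : IsProbabilityMeasure (mixLaw k f) := by
  constructor
  unfold mixLaw
  rw [Measure.add_apply, Measure.smul_apply, Measure.smul_apply, Measure.map_apply hf .univ]
  simp only [preimage_univ, Measure.restrict_apply_univ, Real.volume_Icc, sub_zero,
    ENNReal.ofReal_one, smul_eq_mul, mul_one, measure_univ]
  rw [← ENNReal.ofReal_add hk0 (by linarith)]
  simp

lemma volume_real_lt_inter {s : ℝ} (hs : 0 ≤ s) :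
    volume.real ({t | t < s} ∩ Icc (0 : ℝ) 1) = min 1 s := by
  rcases le_or_gt s 1 with h | h
  · have : {t | t < s} ∩ Icc (0 : ℝ) 1 = Ico 0 s := by
      ext t
      simp only [mem_inter_iff, mem_ofPred_eq, mem_Icc, mem_Ico]
      exact ⟨fun ht => ⟨ht.2.1, ht.1⟩, fun ht => ⟨ht.2, ht.1, by linarith [ht.2]⟩⟩
    rw [this, min_eq_right h, Real.volume_real_Ico_of_le hs, sub_zero]
  · have : {t | t < s} ∩ Icc (0 : ℝ) 1 = Icc 0 1 :=
      inter_eq_right.2 fun t ht => lt_of_le_of_lt ht.2 h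
    rw [this, min_eq_left h.le, Real.volume_real_Icc_of_le zero_le_one, sub_zero]

lemma volume_real_le_inter {s : ℝ} (hs : 0 ≤ s) :
    volume.real ({t | t ≤ s} ∩ Icc (0 : ℝ) 1) = min 1 s := by
  have : {t | t ≤ s} ∩ Icc (0 : ℝ) 1 = Icc 0 (min 1 s) := by
    ext t
    simp only [mem_inter_iff, mem_ofPred_eq, mem_Icc, le_min_iff]
    tauto
  rw [this, Real.volume_real_Icc_of_le (le_min zero_le_one hs), sub_zero]

variable {g ginv : ℝ≥0 → ℝ≥0} {a b v kp kj : ℝ}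

lemma measurable_txLaw_map (hgm : StrictMono g) : Measurable fun t => g (2 * v * t).toNNReal :=
  hgm.monotone.measurable.comp (by fun_prop)

lemma monotone_of_le_iff (hgal : ∀ x y, ginv x ≤ y ↔ x ≤ g y) : Monotone ginv :=
  GaloisConnection.monotone_l hgal

lemma measurable_jamLaw_map (hgal : ∀ x y, ginv x ≤ y ↔ x ≤ g y) (G : ℝ) :
    Measurable fun t => ginv (G * t).toNNReal :=
  (monotone_of_le_iff hgal).measurable.comp (by fun_prop)

lemma txLoss_txLaw
    (hpar : IsEquilibriumParameter (fun y : ℝ => (g y.toNNReal : ℝ)) a b v kp kj)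
    (hgm : StrictMono g) (hg0 : 0 < g 0) (y : ℝ≥0) :
    txLoss g (txLaw g kp v) y = kp * min 1 (y / (2 * v)) + (1 - kp) := by
  have hv := hpar.v_pos
  have h0 : 0 < g y := hg0.trans_le (hgm.monotone zero_le)
  unfold txLoss txLaw
  rw [mixLaw_real_apply hpar.kp_pos.le hpar.kp_le (measurable_txLaw_map hgm)
    (show MeasurableSet {x | x < g y} from measurableSet_Iio),
    ← volume_real_lt_inter (by positivity),
    indicator_of_mem (show (0 : ℝ≥0) ∈ {x | x < g y} from h0),
    mul_one]
  congr 3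
  ext t
  simp only [mem_inter_iff, mem_preimage, mem_ofPred_eq, hgm.lt_iff_lt, and_congr_left_iff]
  intro ht
  rw [Real.toNNReal_lt_iff_lt_coe (by have := ht.1; positivity), lt_div_iff₀ (by positivity)]
  rw [mul_comm t]

lemma txLaw_Iic
    (hpar : IsEquilibriumParameter (fun y : ℝ => (g y.toNNReal : ℝ)) a b v kp kj)
    (hgm : StrictMono g) (y : ℝ≥0) :
    (txLaw g kp v).real (Iic (g y)) = kp * min 1 (y / (2 * v)) + (1 - kp) := by
  have hv := hpar.v_pos
  unfold txLaw
  rw [mixLaw_real_apply hpar.kp_pos.le hpar.kp_le (measurable_txLaw_map hgm) measurableSet_Iic,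
    ← volume_real_le_inter (by positivity),
    indicator_of_mem (show (0 : ℝ≥0) ∈ Iic (g y) from mem_Iic.2 zero_le),
    mul_one]
  congr 3
  ext t
  simp only [mem_inter_iff, mem_preimage, mem_ofPred_eq, mem_Iic, hgm.le_iff_le,
    and_congr_left_iff]
  intro ht
  rw [Real.toNNReal_le_iff_le_coe, le_div_iff₀ (by positivity)]
  rw [mul_comm t]

lemma txLaw_Iic_of_lt
    (hpar : IsEquilibriumParameter (fun y : ℝ => (g y.toNNReal : ℝ)) a b v kp kj)
    (hgm : StrictMono g) {x : ℝ≥0} (hx : x < g 0) :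
    (txLaw g kp v).real (Iic x) = 1 - kp := by
  unfold txLaw
  rw [mixLaw_real_apply hpar.kp_pos.le hpar.kp_le (measurable_txLaw_map hgm) measurableSet_Iic,
    indicator_of_mem (show (0 : ℝ≥0) ∈ Iic x from mem_Iic.2 zero_le)]
  have : (fun t => g (2 * v * t).toNNReal) ⁻¹' Iic x = ∅ := by
    ext t
    simp only [mem_preimage, mem_Iic, mem_empty_iff_false, iff_false, not_le]
    exact hx.trans_le (hgm.monotone zero_le)
  rw [this]
  simp

lemma jamLaw_Iic
    (hpar : IsEquilibriumParameter (fun y : ℝ => (g y.toNNReal : ℝ)) a b v kp kj)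
    (hgal : ∀ x y, ginv x ≤ y ↔ x ≤ g y) (ha : 0 < a) (y : ℝ≥0) :
    (jamLaw ginv kj (g (2 * v).toNNReal)).real (Iic y)
      = kj * min 1 ((g y : ℝ) / g (2 * v).toNNReal) + (1 - kj) := by
  have hG : (0 : ℝ) < g (2 * v).toNNReal := ha.trans hpar.a_lt
  unfold jamLaw
  rw [mixLaw_real_apply hpar.kj_pos.le hpar.kj_le (measurable_jamLaw_map hgal _) measurableSet_Iic,
    ← volume_real_le_inter (by positivity),
    indicator_of_mem (show (0 : ℝ≥0) ∈ Iic y from mem_Iic.2 zero_le),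
    mul_one]
  congr 3
  ext t
  simp only [mem_inter_iff, mem_preimage, mem_ofPred_eq, mem_Iic, hgal, and_congr_left_iff]
  intro ht
  rw [Real.toNNReal_le_iff_le_coe, le_div_iff₀ hG]
  rw [mul_comm t]

lemma txGain_jamLaw
    (hpar : IsEquilibriumParameter (fun y : ℝ => (g y.toNNReal : ℝ)) a b v kp kj)
    (hgm : StrictMono g) (hgal : ∀ x y, ginv x ≤ y ↔ x ≤ g y) (ha : 0 < a)
    (y : ℝ≥0) : txGain g (jamLaw ginv kj (g (2 * v).toNNReal)) (g y)
      = kj * min 1 ((g y : ℝ) / g (2 * v).toNNReal) + (1 - kj) := by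
  rw [← jamLaw_Iic hpar hgal ha]
  unfold txGain
  simp only [hgm.le_iff_le]
  rfl

lemma txGain_of_lt (hgm : StrictMono g) {ν : Measure ℝ≥0} {x : ℝ≥0} (hx : x < g 0) :
    txGain g ν x = 0 := by
  have : {y | g y ≤ x} = ∅ := by
    ext y
    simp only [mem_ofPred_eq, mem_empty_iff_false, iff_false, not_le]
    exact hx.trans_le (hgm.monotone zero_le)
  rw [txGain, this]
  simp

lemma txLaw_mem
    (hpar : IsEquilibriumParameter (fun y : ℝ => (g y.toNNReal : ℝ)) a b v kp kj)
    (hgc : Continuous g) (hgm : StrictMono g) : txLaw g kp v ∈ averageLaws a := by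
  have hv := hpar.v_pos
  refine ⟨isProbabilityMeasure_mixLaw hpar.kp_pos.le hpar.kp_le (measurable_txLaw_map hgm), ?_⟩
  have hcont : Continuous fun y : ℝ => (g y.toNNReal : ℝ) := by fun_prop
  unfold txLaw mixLaw
  rw [lintegral_add_measure, lintegral_smul_measure, lintegral_smul_measure, lintegral_dirac,
    lintegral_map (by fun_prop) (measurable_txLaw_map hgm)]
  simp only [ENNReal.coe_zero, smul_eq_mul, mul_zero, add_zero]
  have h1 : ∫⁻ t in Icc (0 : ℝ) 1, (g (2 * v * t).toNNReal : ℝ≥0∞)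
      = ENNReal.ofReal (∫ t in (0 : ℝ)..1, (g (2 * v * t).toNNReal : ℝ)) := by
    rw [intervalIntegral.integral_of_le zero_le_one, ← integral_Icc_eq_integral_Ioc,
      ofReal_integral_eq_lintegral_ofReal]
    · simp
    · exact ((hcont.comp (continuous_const.mul continuous_id)).continuousOn).integrableOn_Icc
    · exact Filter.Eventually.of_forall fun t => NNReal.coe_nonneg _
  rw [h1, ← ENNReal.ofReal_mul hpar.kp_pos.le]
  apply ENNReal.ofReal_le_ofReal
  rw [intervalIntegral.integral_comp_mul_left (fun y : ℝ => (g y.toNNReal : ℝ))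
    (show 2 * v ≠ 0 by positivity)]
  have h2 := hpar.tx_budget
  rw [mul_zero, mul_one, smul_eq_mul, mul_left_comm, h2]
  apply le_of_eq
  field_simp

lemma jamLaw_mem
    (hpar : IsEquilibriumParameter (fun y : ℝ => (g y.toNNReal : ℝ)) a b v kp kj)
    (hgc : Continuous g) (hgm : StrictMono g)
    (hgal : ∀ x y, ginv x ≤ y ↔ x ≤ g y) (ha : 0 < a) :
    jamLaw ginv kj (g (2 * v).toNNReal) ∈ averageLaws b := by
  have hv := hpar.v_pos
  have hG : (0 : ℝ) < g (2 * v).toNNReal := ha.trans hpar.a_lt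
  have hcdf := jamLaw_Iic hpar hgal ha
  have hprob : IsProbabilityMeasure (jamLaw ginv kj (g (2 * v).toNNReal)) :=
    isProbabilityMeasure_mixLaw hpar.kj_pos.le hpar.kj_le (measurable_jamLaw_map hgal _)
  refine ⟨hprob, ?_⟩
  have hcont : Continuous fun y : ℝ => (g y.toNNReal : ℝ) := by fun_prop
  set ν := jamLaw ginv kj (g (2 * v).toNNReal)
  have h1 : ∫⁻ y : ℝ≥0, (y : ℝ≥0∞) ∂ν = ∫⁻ t in Ioi (0 : ℝ), ν {y : ℝ≥0 | t < (y : ℝ)} := by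
    rw [← lintegral_eq_lintegral_meas_lt ν
      (Filter.Eventually.of_forall fun y : ℝ≥0 => y.coe_nonneg)
      NNReal.continuous_coe.measurable.aemeasurable]
    simp
  have h2 : ∀ t : ℝ, 0 ≤ t → ν {y : ℝ≥0 | t < (y : ℝ)}
      = ENNReal.ofReal (kj * (1 - min 1 ((g t.toNNReal : ℝ) / g (2 * v).toNNReal))) := by
    intro t ht
    have h3 : {y : ℝ≥0 | t < (y : ℝ)} = (Iic t.toNNReal)ᶜ := by
      ext y
      simp only [mem_ofPred_eq, mem_compl_iff, mem_Iic, not_le]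
      rw [Real.toNNReal_lt_iff_lt_coe ht]
    rw [← ofReal_measureReal (measure_ne_top _ _), h3, probReal_compl_eq_one_sub measurableSet_Iic,
      hcdf]
    congr 1
    ring
  have hle1 : ∀ t : ℝ, t ≤ 2 * v → (g t.toNNReal : ℝ) / g (2 * v).toNNReal ≤ 1 := by
    intro t ht
    rw [div_le_one hG]
    exact_mod_cast hgm.monotone (Real.toNNReal_le_toNNReal ht)
  rw [h1, ← Ioc_union_Ioi_eq_Ioi (show (0 : ℝ) ≤ 2 * v by positivity),
    lintegral_union measurableSet_Ioi (Ioc_disjoint_Ioi le_rfl),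
    setLIntegral_congr_fun (g := fun t => ENNReal.ofReal
      (kj * (1 - g t.toNNReal / g (2 * v).toNNReal))) measurableSet_Ioc
      (fun t ht => by
        simp only
        rw [h2 t ht.1.le, min_eq_right (hle1 t ht.2)]),
    setLIntegral_congr_fun (g := fun _ => 0) measurableSet_Ioi (fun t (ht : 2 * v < t) => by
        have h3 : 1 ≤ (g t.toNNReal : ℝ) / g (2 * v).toNNReal := by
          rw [one_le_div hG]
          exact_mod_cast hgm.monotone (Real.toNNReal_le_toNNReal ht.le)
        simp only
        rw [h2 t (by linarith), min_eq_left h3]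
        simp)]
  rw [lintegral_zero, add_zero, ← ofReal_integral_eq_lintegral_ofReal,
    ← intervalIntegral.integral_of_le (by positivity)]
  · apply ENNReal.ofReal_le_ofReal
    rw [intervalIntegral.integral_const_mul, intervalIntegral.integral_sub
      (intervalIntegrable_const) (Continuous.intervalIntegrable (by fun_prop) _ _),
      intervalIntegral.integral_div, intervalIntegral.integral_const]
    have h3 := hpar.jam_budget
    simp only [sub_zero, smul_eq_mul, mul_one]
    have h4 : kj * (2 * v - (∫ x in (0 : ℝ)..2 * v, (g x.toNNReal : ℝ)) / g (2 * v).toNNReal)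
        * g (2 * v).toNNReal = b * g (2 * v).toNNReal := by
      rw [← h3]
      field_simp
    exact (mul_right_cancel₀ hG.ne' h4).le
  · exact (Continuous.continuousOn (by fun_prop)).integrableOn_Icc.mono_set Ioc_subset_Icc_self
  · filter_upwards [ae_restrict_mem measurableSet_Ioc] with t ht
    exact mul_nonneg hpar.kj_pos.le (by linarith [hle1 t ht.2])

/-- Against `F_P`, the outage probability is below a line through `(b, V)`, with equality exactly
on `[0, 2v]`. -/
lemma txLoss_txLaw_le
    (hpar : IsEquilibriumParameter (fun y : ℝ => (g y.toNNReal : ℝ)) a b v kp kj)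
    (hgm : StrictMono g) (hg0 : 0 < g 0) (y : ℝ≥0) :
    txLoss g (txLaw g kp v) y
      ≤ (1 - kp + kp * (b / (2 * v))) + kp / (2 * v) * ((y : ℝ) - b) := by
  have hv := hpar.v_pos
  rw [txLoss_txLaw hpar hgm hg0]
  have h1 := mul_le_mul_of_nonneg_left (min_le_right 1 ((y : ℝ) / (2 * v))) hpar.kp_pos.le
  have h2 : (1 - kp + kp * (b / (2 * v))) + kp / (2 * v) * ((y : ℝ) - b)
      = kp * (y / (2 * v)) + (1 - kp) := by ring
  linarith

lemma line_jamLaw_eq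
    (hpar : IsEquilibriumParameter (fun y : ℝ => (g y.toNNReal : ℝ)) a b v kp kj)
    (ha : 0 < a) (x : ℝ) :
    (1 - (1 - kp + kp * (b / (2 * v)))) + kj / g (2 * v).toNNReal * (x - a)
      = kj * (x / g (2 * v).toNNReal) + (1 - kj) := by
  have hG : (0 : ℝ) < g (2 * v).toNNReal := ha.trans hpar.a_lt
  rw [hpar.value_eq]
  ring

/-- Against `F_J`, the probability of avoiding outage is below a line through `(a, 1 - V)`, with
equality only on `[g 0, g (2v)]` and possibly at `0`. -/
lemma txGain_jamLaw_le
    (hpar : IsEquilibriumParameter (fun y : ℝ => (g y.toNNReal : ℝ)) a b v kp kj)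
    (hgm : StrictMono g) (hgal : ∀ x y, ginv x ≤ y ↔ x ≤ g y)
    (hsurj : ∀ x, g 0 ≤ x → ∃ y, g y = x) (ha : 0 < a) (x : ℝ≥0) :
    txGain g (jamLaw ginv kj (g (2 * v).toNNReal)) x
      ≤ (1 - (1 - kp + kp * (b / (2 * v)))) + kj / g (2 * v).toNNReal * ((x : ℝ) - a) := by
  have hG : (0 : ℝ) < g (2 * v).toNNReal := ha.trans hpar.a_lt
  rw [line_jamLaw_eq hpar ha]
  have hk := hpar.kj_pos
  have hk1 := hpar.kj_le
  rcases lt_or_ge x (g 0) with hx | hx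
  · rw [txGain_of_lt hgm hx]
    have : 0 ≤ kj * ((x : ℝ) / g (2 * v).toNNReal) := by positivity
    linarith
  · obtain ⟨y, rfl⟩ := hsurj x hx
    rw [txGain_jamLaw hpar hgm hgal ha]
    have h1 := mul_le_mul_of_nonneg_left (min_le_right 1 ((g y : ℝ) / g (2 * v).toNNReal)) hk.le
    linarith

end EquilibriumLaws

/-! ### Optimality and uniqueness in the game between frames -/

lemma measureReal_eq_one_of_ae {α : Type*} [MeasurableSpace α] {μ : Measure α}
    [IsProbabilityMeasure μ] {A : Set α} (h : ∀ᵐ x ∂μ, x ∈ A) : μ.real A = 1 := by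
  rw [Measure.real, measure_congr (show A =ᵐ[μ] univ from Filter.eventuallyEq_univ.2 h),
    measure_univ, ENNReal.toReal_one]

/-- The outage probability at equilibrium. -/
noncomputable def gameValue (b v kp : ℝ) : ℝ := 1 - kp + kp * (b / (2 * v))

/-- The setting of the game between frames: a required-power curve `g`, its generalized inverse
`ginv`, the power budgets `a` of the transmitter and `b` of the jammer, and the parameters that
the case procedure attaches to them. -/
structure FrameSetting (g ginv : ℝ≥0 → ℝ≥0) (a b v kp kj : ℝ) : Prop where
  cont : Continuous g
  strictMono : StrictMono g
  zero_pos : 0 < g 0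
  inv_le_iff : ∀ x y, ginv x ≤ y ↔ x ≤ g y
  surj : ∀ x, g 0 ≤ x → ∃ y, g y = x
  a_pos : 0 < a
  b_pos : 0 < b
  par : IsEquilibriumParameter (fun y : ℝ => (g y.toNNReal : ℝ)) a b v kp kj

namespace FrameSetting

variable {g ginv : ℝ≥0 → ℝ≥0} {a b v kp kj : ℝ} (H : FrameSetting g ginv a b v kp kj)
  {μ ν : Measure ℝ≥0}

include H

lemma top_pos : (0 : ℝ) < g (2 * v).toNNReal := H.a_pos.trans H.par.a_lt

lemma coe_top : (((2 * v).toNNReal : ℝ≥0) : ℝ) = 2 * v :=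
  Real.coe_toNNReal _ (by linarith [H.par.v_pos])

lemma b_lt : b < 2 * v := by linarith [H.par.v_pos, H.par.b_le]

lemma isProbabilityMeasure_txLaw : IsProbabilityMeasure (txLaw g kp v) :=
  (txLaw_mem H.par H.cont H.strictMono).1

lemma jamLaw_mem' : jamLaw ginv kj (g (2 * v).toNNReal) ∈ averageLaws b :=
  jamLaw_mem H.par H.cont H.strictMono H.inv_le_iff H.a_pos

lemma isProbabilityMeasure_jamLaw :
    IsProbabilityMeasure (jamLaw ginv kj (g (2 * v).toNNReal)) := H.jamLaw_mem'.1

theorem loss_txLaw_le (hν : ν ∈ averageLaws b) : loss g (txLaw g kp v) ν ≤ gameValue b v kp := by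
  have := hν.1
  have := H.isProbabilityMeasure_txLaw
  rw [loss_eq_integral_txLoss H.strictMono.monotone.measurable]
  exact integral_le_of_le_line H.b_pos.le
    (div_nonneg H.par.kp_pos.le (by linarith [H.par.v_pos]))
    (integrable_txLoss H.strictMono.monotone) hν (txLoss_txLaw_le H.par H.strictMono H.zero_pos)

theorem le_loss_jamLaw (hμ : μ ∈ averageLaws a) :
    gameValue b v kp ≤ loss g μ (jamLaw ginv kj (g (2 * v).toNNReal)) := by
  have := hμ.1
  have := H.isProbabilityMeasure_jamLaw
  have h1 := one_sub_loss_eq_integral_txGain (μ := μ)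
    (ν := jamLaw ginv kj (g (2 * v).toNNReal)) H.strictMono.monotone.measurable
  have h2 := integral_le_of_le_line H.a_pos.le (div_nonneg H.par.kj_pos.le H.top_pos.le)
    integrable_txGain hμ (txGain_jamLaw_le H.par H.strictMono H.inv_le_iff H.surj H.a_pos)
  unfold gameValue
  linarith

/-- A transmitter law that is optimal against `F_J` never wastes power: it uses no power in
`(0, g 0)` and none beyond `g (2v)`. -/
lemma ae_eq_zero_or_mem_Icc (hμ : μ ∈ averageLaws a)
    (hopt : loss g μ (jamLaw ginv kj (g (2 * v).toNNReal)) ≤ gameValue b v kp) :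
    ∀ᵐ x ∂μ, x = 0 ∨ x ∈ Icc (g 0) (g (2 * v).toNNReal) := by
  have := hμ.1
  have := H.isProbabilityMeasure_jamLaw
  have h1 := one_sub_loss_eq_integral_txGain (μ := μ)
    (ν := jamLaw ginv kj (g (2 * v).toNNReal)) H.strictMono.monotone.measurable
  have h2 := ae_eq_line H.a_pos.le (div_nonneg H.par.kj_pos.le H.top_pos.le)
    integrable_txGain hμ (txGain_jamLaw_le H.par H.strictMono H.inv_le_iff H.surj H.a_pos)
    (by rw [← h1]; unfold gameValue at hopt; linarith)
  have hG := H.top_pos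
  have hk := H.par.kj_pos
  have hk1 := H.par.kj_le
  filter_upwards [h2] with x hx
  rw [line_jamLaw_eq H.par H.a_pos] at hx
  rcases lt_or_ge x (g 0) with hx0 | hx0
  · left
    rw [txGain_of_lt H.strictMono hx0] at hx
    by_contra hne
    have hx1 : (0 : ℝ) < x := by exact_mod_cast pos_iff_ne_zero.2 hne
    have : 0 < kj * ((x : ℝ) / g (2 * v).toNNReal) := by positivity
    linarith
  · right
    refine ⟨hx0, ?_⟩
    obtain ⟨y, rfl⟩ := H.surj x hx0
    rw [txGain_jamLaw H.par H.strictMono H.inv_le_iff H.a_pos, add_left_inj] at hx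
    have h3 := min_eq_right_iff.1 (mul_left_cancel₀ hk.ne' hx)
    rw [div_le_one hG] at h3
    exact_mod_cast h3

/-- An optimal transmitter law gives the jammer a linear outage probability on `[0, 2v]`: it is
below a line by optimality, and meets it wherever `F_J` has mass. -/
lemma txLoss_of_optimal (hμ : μ ∈ averageLaws a)
    (hopt : ∀ ν ∈ averageLaws b, loss g μ ν ≤ gameValue b v kp) (y : ℝ≥0) :
    txLoss g μ y = kp * min 1 (y / (2 * v)) + (1 - kp) := by
  have := hμ.1
  have := H.isProbabilityMeasure_jamLaw
  have hgm := H.strictMono.monotone.measurable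
  have hG := H.top_pos
  have hv := H.par.v_pos
  have hbv := H.b_lt
  have hk := H.par.kj_pos
  have hk1 := H.par.kj_le
  have hsupp := H.ae_eq_zero_or_mem_Icc hμ (hopt _ H.jamLaw_mem')
  obtain ⟨s, hs, hline⟩ := exists_supporting_line (f := txLoss g μ) (V := gameValue b v kp) H.b_pos
    fun ν hν => by
      have := hν.1
      rw [← loss_eq_integral_txLoss hgm]
      exact hopt ν hν
  have hae := ae_eq_line H.b_pos.le hs (integrable_txLoss H.strictMono.monotone) H.jamLaw_mem' hline
    (by rw [← loss_eq_integral_txLoss hgm]; exact H.le_loss_jamLaw hμ)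
  have hcdf := jamLaw_Iic H.par H.inv_le_iff H.a_pos
  have heq : ∀ y ≤ (2 * v).toNNReal, txLoss g μ y = gameValue b v kp + s * ((y : ℝ) - b) := by
    intro y hy
    refine le_antisymm (hline y) ?_
    rcases eq_or_ne y 0 with rfl | hy0
    · have h1 : (jamLaw ginv kj (g (2 * v).toNNReal)) (Iic 0) ≠ 0 := by
        intro h0
        have h2 := hcdf 0
        rw [Measure.real, h0, ENNReal.toReal_zero] at h2
        have h3 : 0 < min 1 ((g 0 : ℝ) / g (2 * v).toNNReal) :=
          lt_min one_pos (div_pos (by exact_mod_cast H.zero_pos) hG)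
        nlinarith [mul_pos hk h3]
      obtain ⟨z, hz, hz2⟩ := ((frequently_ae_mem_iff.2 h1).and_eventually hae).exists
      have : z = 0 := le_antisymm hz zero_le
      rw [this] at hz2
      exact hz2.ge
    · refine le_of_forall_lt_le (k := fun y : ℝ≥0 => gameValue b v kp + s * ((y : ℝ) - b))
        (by fun_prop) (pos_iff_ne_zero.2 hy0) fun z hz => ?_
      have hzy : (g z : ℝ) / g (2 * v).toNNReal < g y / g (2 * v).toNNReal :=
        div_lt_div_of_pos_right (by exact_mod_cast H.strictMono hz) hG
      have hy1 : (g y : ℝ) / g (2 * v).toNNReal ≤ 1 := by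
        rw [div_le_one hG]
        exact_mod_cast H.strictMono.monotone hy
      obtain ⟨x, hx, hxe⟩ := exists_mem_Ioc_of_ae hae hz.le (by
        rw [hcdf, hcdf, min_eq_right hy1, min_eq_right (hzy.le.trans hy1)]
        nlinarith)
      have h1 := monotone_txLoss (μ := μ) H.strictMono.monotone hx.2
      have h2 : (z : ℝ) ≤ x := by exact_mod_cast hx.1.le
      nlinarith
  have hone : ∀ y, (2 * v).toNNReal < y → txLoss g μ y = 1 := by
    intro y hy
    have h1 : ∀ᵐ x ∂μ, x ∈ {x | x < g y} := by
      filter_upwards [hsupp] with x hx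
      rcases hx with rfl | hx
      · exact H.zero_pos.trans_le (H.strictMono.monotone zero_le)
      · exact lt_of_le_of_lt hx.2 (H.strictMono hy)
    exact measureReal_eq_one_of_ae h1
  -- the line passes through `1` at `2v`, which determines its slope
  have hs1 : 1 ≤ gameValue b v kp + s * (((2 * v).toNNReal : ℝ) - b) :=
    le_of_forall_gt_le (k := fun y : ℝ≥0 => gameValue b v kp + s * ((y : ℝ) - b)) (by fun_prop)
      fun z hz => (hone z hz).ge.trans (hline z)
  have hs2 : gameValue b v kp + s * (((2 * v).toNNReal : ℝ) - b) ≤ 1 :=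
    (heq _ le_rfl).ge.trans (txLoss_le_one _)
  rw [H.coe_top] at hs1 hs2
  have hsv : s = kp / (2 * v) := by
    have h1 : s * (2 * v - b) = kp / (2 * v) * (2 * v - b) := by
      have : kp / (2 * v) * (2 * v - b) = 1 - gameValue b v kp := by
        unfold gameValue
        field_simp
        ring
      linarith
    exact mul_right_cancel₀ (sub_pos.2 hbv).ne' h1
  rcases le_or_gt y (2 * v).toNNReal with hy | hy
  · have hy' : (y : ℝ) ≤ 2 * v := by
      rw [← H.coe_top]
      exact_mod_cast hy
    rw [heq y hy, hsv, min_eq_right ((div_le_one (by positivity)).2 hy'), gameValue]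
    ring
  · have hy' : 2 * v ≤ y := by
      rw [← H.coe_top]
      exact_mod_cast hy.le
    rw [hone y hy, min_eq_left ((one_le_div (by positivity)).2 hy')]
    ring

/-- Besides the outage probabilities, which fix the law on `[g 0, ∞)`, uniqueness needs that no
optimal law has mass in `(0, g 0)`. -/
theorem eq_txLaw_of_optimal (hμ : μ ∈ averageLaws a)
    (hopt : ∀ ν ∈ averageLaws b, loss g μ ν ≤ gameValue b v kp) : μ = txLaw g kp v := by
  have := hμ.1
  have := H.isProbabilityMeasure_txLaw
  have hmem := txLaw_mem H.par H.cont H.strictMono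
  have hoptP : ∀ ν ∈ averageLaws b, loss g (txLaw g kp v) ν ≤ gameValue b v kp :=
    fun ν hν => H.loss_txLaw_le hν
  have hIci : ∀ (ρ : Measure ℝ≥0) [IsProbabilityMeasure ρ] (y : ℝ≥0),
      ρ (Ici (g y)) = ENNReal.ofReal (1 - txLoss g ρ y) := by
    intro ρ _ y
    rw [txLoss, ← probReal_compl_eq_one_sub
      (show MeasurableSet {x | x < g y} from measurableSet_Iio),
      ofReal_measureReal (measure_ne_top _ _)]
    congr 1
    ext x
    simp
  have hge : ∀ x, g 0 ≤ x → μ (Ici x) = txLaw g kp v (Ici x) := by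
    intro x hx
    obtain ⟨y, rfl⟩ := H.surj x hx
    rw [hIci, hIci, H.txLoss_of_optimal hμ hopt, H.txLoss_of_optimal hmem hoptP]
  have hgap : ∀ ρ ∈ averageLaws a, (∀ ν ∈ averageLaws b, loss g ρ ν ≤ gameValue b v kp) →
      ∀ x, 0 < x → x < g 0 → ρ (Ici x) = ρ (Ici (g 0)) := by
    intro ρ hρ hρopt x hx0 hx
    refine measure_congr ?_
    filter_upwards [H.ae_eq_zero_or_mem_Icc hρ (hρopt _ H.jamLaw_mem')] with t ht
    apply propext
    change x ≤ t ↔ g 0 ≤ t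
    rcases ht with rfl | ht
    · exact iff_of_false (not_le.2 hx0) (not_le.2 H.zero_pos)
    · exact iff_of_true (hx.le.trans ht.1) ht.1
  refine Measure.ext_of_Ici _ _ fun x => ?_
  rcases lt_or_ge x (g 0) with hx | hx
  · rcases eq_or_ne x 0 with rfl | hx0
    · rw [show Ici (0 : ℝ≥0) = univ by ext; simp, measure_univ, measure_univ]
    · rw [hgap μ hμ hopt x (pos_iff_ne_zero.2 hx0) hx,
        hgap _ hmem hoptP x (pos_iff_ne_zero.2 hx0) hx, hge _ le_rfl]
  · exact hge x hx

/-- A jammer law that is optimal against `F_P` puts no mass beyond `2v`. -/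
lemma ae_le_top (hν : ν ∈ averageLaws b) (hopt : gameValue b v kp ≤ loss g (txLaw g kp v) ν) :
    ∀ᵐ y ∂ν, y ≤ (2 * v).toNNReal := by
  have := hν.1
  have := H.isProbabilityMeasure_txLaw
  have hv := H.par.v_pos
  have h2 := ae_eq_line H.b_pos.le (div_nonneg H.par.kp_pos.le (by linarith))
    (integrable_txLoss H.strictMono.monotone) hν (txLoss_txLaw_le H.par H.strictMono H.zero_pos)
    (by rw [← loss_eq_integral_txLoss H.strictMono.monotone.measurable]; exact hopt)
  filter_upwards [h2] with y hy
  rw [txLoss_txLaw H.par H.strictMono H.zero_pos] at hy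
  have h3 : kp * min 1 ((y : ℝ) / (2 * v)) = kp * (y / (2 * v)) := by
    have h4 : (1 - kp + kp * (b / (2 * v))) + kp / (2 * v) * ((y : ℝ) - b)
      = kp * (y / (2 * v)) + (1 - kp) := by ring
    linarith
  have h4 := min_eq_right_iff.1 (mul_left_cancel₀ H.par.kp_pos.ne' h3)
  rw [div_le_one (by positivity), ← H.coe_top] at h4
  exact_mod_cast h4

/-- An optimal jammer law gives the transmitter a probability of success that is linear on
`(g 0, g (2v)]`: it is below a line by optimality, and meets it wherever `F_P` has mass. -/
theorem eq_jamLaw_of_optimal (hν : ν ∈ averageLaws b)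
    (hopt : ∀ μ ∈ averageLaws a, gameValue b v kp ≤ loss g μ ν) :
    ν = jamLaw ginv kj (g (2 * v).toNNReal) := by
  have := hν.1
  have := H.isProbabilityMeasure_txLaw
  have := H.isProbabilityMeasure_jamLaw
  have hgm := H.strictMono.monotone.measurable
  have hG := H.top_pos
  have hv := H.par.v_pos
  have hk := H.par.kp_pos
  have hmem := txLaw_mem H.par H.cont H.strictMono
  have hsupp := H.ae_le_top hν (hopt _ hmem)
  obtain ⟨t, ht, hline⟩ := exists_supporting_line (f := txGain g ν) (V := 1 - gameValue b v kp)
    H.a_pos fun μ hμ => by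
      have := hμ.1
      rw [← one_sub_loss_eq_integral_txGain hgm]
      linarith [hopt μ hμ]
  have hae := ae_eq_line H.a_pos.le ht integrable_txGain hmem hline
    (by rw [← one_sub_loss_eq_integral_txGain hgm]; linarith [H.loss_txLaw_le hν])
  have heq : ∀ y, 0 < y → y ≤ (2 * v).toNNReal →
      txGain g ν (g y) = 1 - gameValue b v kp + t * ((g y : ℝ) - a) := by
    intro y hy0 hy
    refine le_antisymm (hline _) ?_
    have hgc := H.cont
    refine le_of_forall_lt_le (k := fun y : ℝ≥0 => 1 - gameValue b v kp + t * ((g y : ℝ) - a))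
      (by fun_prop) hy0 fun z hz => ?_
    have hzy : (z : ℝ) / (2 * v) < y / (2 * v) :=
      div_lt_div_of_pos_right (by exact_mod_cast hz) (by positivity)
    have hy1 : (y : ℝ) / (2 * v) ≤ 1 := by
      rw [div_le_one (by positivity), ← H.coe_top]
      exact_mod_cast hy
    obtain ⟨x, hx, hxe⟩ := exists_mem_Ioc_of_ae hae (H.strictMono hz).le (by
      rw [txLaw_Iic H.par H.strictMono, txLaw_Iic H.par H.strictMono, min_eq_right hy1,
        min_eq_right (hzy.le.trans hy1)]
      nlinarith)
    have h1 := monotone_txGain (g := g) (ν := ν) hx.2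
    have h2 : (g z : ℝ) ≤ x := by exact_mod_cast hx.1.le
    nlinarith
  have hone : ∀ y, (2 * v).toNNReal ≤ y → txGain g ν (g y) = 1 := by
    intro y hy
    have h1 : ∀ᵐ z ∂ν, z ∈ {z | g z ≤ g y} := by
      filter_upwards [hsupp] with z hz using H.strictMono.monotone (hz.trans hy)
    exact measureReal_eq_one_of_ae h1
  have htop : (1 : ℝ) = 1 - gameValue b v kp + t * ((g (2 * v).toNNReal : ℝ) - a) := by
    rw [← heq _ (Real.toNNReal_pos.2 (by positivity)) le_rfl, hone _ le_rfl]
  have hval : gameValue b v kp = kj * (1 - a / g (2 * v).toNNReal) := H.par.value_eq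
  have htk : t = kj / g (2 * v).toNNReal := by
    have h1 : t * ((g (2 * v).toNNReal : ℝ) - a)
        = kj / g (2 * v).toNNReal * ((g (2 * v).toNNReal : ℝ) - a) := by
      have : kj / g (2 * v).toNNReal * ((g (2 * v).toNNReal : ℝ) - a)
          = kj * (1 - a / g (2 * v).toNNReal) := by
        field_simp
      linarith
    exact mul_right_cancel₀ (sub_pos.2 H.par.a_lt).ne' h1
  refine ext_of_Iic_pos fun y hy0 => ?_
  have hgain : ν.real (Iic y) = txGain g ν (g y) := by
    unfold txGain
    simp only [H.strictMono.le_iff_le]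
    rfl
  have : ν.real (Iic y) = (jamLaw ginv kj (g (2 * v).toNNReal)).real (Iic y) := by
    rw [hgain, jamLaw_Iic H.par H.inv_le_iff H.a_pos]
    rcases le_total y (2 * v).toNNReal with hy | hy
    · have hy1 : (g y : ℝ) / g (2 * v).toNNReal ≤ 1 := by
        rw [div_le_one hG]
        exact_mod_cast H.strictMono.monotone hy
      rw [heq y hy0 hy, min_eq_right hy1, htk, hval]
      field_simp
      ring
    · have hy1 : 1 ≤ (g y : ℝ) / g (2 * v).toNNReal := by
        rw [one_le_div hG]
        exact_mod_cast H.strictMono.monotone hy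
      rw [hone y hy, min_eq_left hy1]
      ring
  exact (measureReal_eq_measureReal_iff (measure_ne_top _ _) (measure_ne_top _ _)).1 this

end FrameSetting

/-! ### From frame powers to power allocations -/

/-- In a zero-sum game with a saddle point, a pair of strategies is an equilibrium exactly if both
are optimal. -/
lemma isNashEquilibrium_iff {α β : Type*} {A : Set α} {B : Set β} {u : α → β → ℝ≥0∞} {W : ℝ≥0∞}
    {a₀ : α} {b₀ : β} (ha₀ : a₀ ∈ A) (hb₀ : b₀ ∈ B) (h1 : ∀ b ∈ B, u a₀ b ≤ W)
    (h2 : ∀ a ∈ A, W ≤ u a b₀) (a : α) (b : β) :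
    IsNashEquilibrium A B u a b ↔
      a ∈ A ∧ b ∈ B ∧ (∀ b' ∈ B, u a b' ≤ W) ∧ ∀ a' ∈ A, W ≤ u a' b := by
  constructor
  · rintro ⟨ha, hb, h3, h4⟩
    have h5 : u a b ≤ W := (h3 a₀ ha₀).trans (h1 b hb)
    have h6 : W ≤ u a b := (h2 a ha).trans (h4 b₀ hb₀)
    exact ⟨ha, hb, fun b' hb' => (h4 b' hb').trans h5, fun a' ha' => h6.trans (h3 a' ha')⟩
  · rintro ⟨ha, hb, h3, h4⟩
    exact ⟨ha, hb, fun a' ha' => (h3 b hb).trans (h4 a' ha'),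
      fun b' hb' => (h3 b' hb').trans (h4 a ha)⟩

section FrameLaw

variable {m : Measure ℝ} [IsProbabilityMeasure m] {N R : ℝ}

lemma measurable_meanPower (S : MixedAllocation) : Measurable fun ω => meanPower m (S.power ω) :=
  Measurable.lintegral_prod_right' (f := fun z : S.Ω × ℝ => (S.power z.1 z.2 : ℝ≥0∞))
    S.measurable_power.coe_nnreal_ennreal

lemma measurable_power_apply (S : MixedAllocation) (ω : S.Ω) : Measurable (S.power ω) :=
  S.measurable_power.comp measurable_prodMk_left

lemma frameLaw_mem {S : MixedAllocation} {a : ℝ} (hS : S ∈ averagePower m a) :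
    frameLaw m S ∈ averageLaws a := by
  have hm := (measurable_meanPower (m := m) S).ennreal_toNNReal
  refine ⟨Measure.isProbabilityMeasure_map hm.aemeasurable, ?_⟩
  unfold frameLaw
  rw [lintegral_map (by fun_prop) hm]
  exact (lintegral_mono fun ω => ENNReal.coe_toNNReal_le_self).trans hS

lemma ae_coe_frame_eq {S : MixedAllocation} {a : ℝ} (hS : S ∈ averagePower m a) :
    ∀ᵐ ω ∂S.law, ((meanPower m (S.power ω)).toNNReal : ℝ≥0∞) = meanPower m (S.power ω) := by
  filter_upwards [ae_lt_top (measurable_meanPower (m := m) S)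
    (lt_of_le_of_lt (show _ ≤ _ from hS) ENNReal.ofReal_lt_top).ne] with ω hω
  exact ENNReal.coe_toNNReal hω.ne

namespace SaddleFamily

variable (F : SaddleFamily m N R)

omit [IsProbabilityMeasure m] in
lemma measurable_level : Measurable F.level := F.strictMono_level.monotone.measurable

/-- The jamming power that brings a transmitter of power `x` down to the rate `R`. -/
noncomputable def spoil (_ : SaddleFamily m N R) (x : ℝ≥0) : ℝ≥0 := (requiredJx m N R x).toNNReal

lemma requiredJx_lt_top (F : SaddleFamily m N R) (hN : 0 < N) (hR : 0 < R) (hpos : ∀ᵐ h ∂m, 0 < h)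
    (x : ℝ≥0) : requiredJx m N R x < ∞ := by
  obtain ⟨y, hy⟩ := F.exists_le_level x
  exact (requiredJx_mono (by exact_mod_cast hy)).trans_lt
    ((F.requiredJx_level hN hR hpos y).trans_lt ENNReal.coe_lt_top)

lemma spoil_level (hN : 0 < N) (hR : 0 < R) (hpos : ∀ᵐ h ∂m, 0 < h) (y : ℝ≥0) :
    F.spoil (F.level y) = y := by
  rw [spoil, F.requiredJx_level hN hR hpos, ENNReal.toNNReal_coe]

lemma spoil_le_iff (hN : 0 < N) (hR : 0 < R) (hpos : ∀ᵐ h ∂m, 0 < h) (x y : ℝ≥0) :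
    F.spoil x ≤ y ↔ x ≤ F.level y := by
  have hmono : Monotone F.spoil := fun x x' h =>
    ENNReal.toNNReal_mono (F.requiredJx_lt_top hN hR hpos x').ne
      (requiredJx_mono (by exact_mod_cast h))
  constructor
  · intro h
    by_contra! hlt
    obtain ⟨z, rfl⟩ := F.exists_level_eq
      ((F.strictMono_level.monotone (zero_le (a := y))).trans hlt.le)
    rw [F.spoil_level hN hR hpos] at h
    exact absurd (F.strictMono_level.lt_iff_lt.1 hlt) (not_lt.2 h)
  · intro h
    exact (hmono h).trans (F.spoil_level hN hR hpos y).le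

/-- The mixed strategy of the transmitter that draws the frame power from `μ` and spends it
at the saddle point at which it is the required power; powers below `level 0` are of no use. -/
noncomputable def txStrategy (μ : Measure ℝ≥0) [IsProbabilityMeasure μ]
    (hspoil : Measurable F.spoil) : MixedAllocation where
  Ω := ℝ≥0
  law := μ
  power x h := if x < F.level 0 then 0 else F.tx (F.spoil x) h
  measurable_power := Measurable.ite (measurableSet_lt measurable_fst measurable_const)
    measurable_const (F.measurable_tx.comp ((hspoil.comp measurable_fst).prodMk measurable_snd))

/-- The mixed strategy of the jammer that draws the frame power from `ν` and spends it at the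
saddle point. -/
noncomputable def jamStrategy (ν : Measure ℝ≥0) [IsProbabilityMeasure ν] : MixedAllocation where
  Ω := ℝ≥0
  law := ν
  power := F.jam
  measurable_power := F.measurable_jam

variable {μ ν : Measure ℝ≥0} [IsProbabilityMeasure μ] [IsProbabilityMeasure ν] {a b : ℝ}

omit [IsProbabilityMeasure m] in
lemma jamStrategy_mem (hν : ν ∈ averageLaws b) : F.jamStrategy ν ∈ averagePower m b := by
  change ∫⁻ y : ℝ≥0, meanPower m (F.jam y) ∂ν ≤ ENNReal.ofReal b
  simp only [F.mean_jam]
  exact hν.2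

lemma level_spoil (hN : 0 < N) (hR : 0 < R) (hpos : ∀ᵐ h ∂m, 0 < h) {x : ℝ≥0}
    (hx : F.level 0 ≤ x) : F.level (F.spoil x) = x := by
  obtain ⟨y, rfl⟩ := F.exists_level_eq hx
  rw [F.spoil_level hN hR hpos]

lemma txStrategy_mem (hN : 0 < N) (hR : 0 < R) (hpos : ∀ᵐ h ∂m, 0 < h)
    (hspoil : Measurable F.spoil) (hμ : μ ∈ averageLaws a) :
    F.txStrategy μ hspoil ∈ averagePower m a := by
  refine (lintegral_mono fun x : ℝ≥0 => ?_).trans hμ.2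
  change meanPower m (fun h => if x < F.level 0 then 0 else F.tx (F.spoil x) h) ≤ x
  by_cases hx : x < F.level 0
  · simp [hx, meanPower]
  · simp only [hx, if_false]
    change meanPower m (F.tx (F.spoil x)) ≤ x
    rw [F.mean_tx, F.level_spoil hN hR hpos (not_lt.1 hx)]

lemma ofReal_loss_eq {g : ℝ≥0 → ℝ≥0} :
    ENNReal.ofReal (loss g μ ν) = (μ.prod ν) {z | z.1 < g z.2} :=
  ofReal_measureReal (measure_ne_top _ _)

lemma lt_level_of_capacity_lt (hN : 0 < N) (hR : 0 < R) (hpos : ∀ᵐ h ∂m, 0 < h) {x : ℝ≥0}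
    {J : ℝ → ℝ≥0} (hJ : Measurable J)
    (hfin : ((meanPower m J).toNNReal : ℝ≥0∞) = meanPower m J)
    (hout : capacity m N (fun h => if x < F.level 0 then 0 else F.tx (F.spoil x) h) J
      < ENNReal.ofReal R) : x < F.level (meanPower m J).toNNReal := by
  by_contra! hle
  have hx : F.level 0 ≤ x := (F.strictMono_level.monotone zero_le).trans hle
  have h1 : meanPower m J ≤ F.spoil x := by
    rw [← hfin]
    rw [← F.level_spoil hN hR hpos hx, F.strictMono_level.le_iff_le] at hle
    exact_mod_cast hle
  simp only [not_lt.2 hx, if_false] at hout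
  exact absurd hout (not_lt.2 (F.tx_secure _ _ hJ h1))

/-- Against `txStrategy μ`, an outage requires a frame power `J_M` with `x < level J_M`. -/
lemma outage_txStrategy_le (hN : 0 < N) (hR : 0 < R) (hpos : ∀ᵐ h ∂m, 0 < h)
    (hspoil : Measurable F.spoil) {T : MixedAllocation} (hT : T ∈ averagePower m b) :
    outage m N R (F.txStrategy μ hspoil) T ≤ ENNReal.ofReal (loss F.level μ (frameLaw m T)) := by
  have hm := (measurable_meanPower (m := m) T).ennreal_toNNReal
  have hprob : IsProbabilityMeasure (frameLaw m T) := (frameLaw_mem hT).1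
  have hmap : μ.prod (frameLaw m T) = (μ.prod T.law).map
      (Prod.map id fun ω => (meanPower m (T.power ω)).toNNReal) := by
    rw [← Measure.map_prod_map _ _ measurable_id hm, Measure.map_id]
    rfl
  rw [ofReal_loss_eq, hmap, Measure.map_apply (measurable_id.prodMap hm)
    (measurableSet_loss F.measurable_level)]
  refine measure_mono_ae ?_
  filter_upwards [Measure.quasiMeasurePreserving_snd.ae (ae_coe_frame_eq hT)] with z hz hout
  exact F.lt_level_of_capacity_lt hN hR hpos (measurable_power_apply T z.2) hz hout

/-- Against `jamStrategy ν`, a frame power `P_M < level y` leads to an outage. -/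
lemma le_outage_jamStrategy {S : MixedAllocation} (hS : S ∈ averagePower m a) :
    ENNReal.ofReal (loss F.level (frameLaw m S) ν) ≤ outage m N R S (F.jamStrategy ν) := by
  have hm := (measurable_meanPower (m := m) S).ennreal_toNNReal
  have hprob : IsProbabilityMeasure (frameLaw m S) := (frameLaw_mem hS).1
  have hmap : (frameLaw m S).prod ν = (S.law.prod ν).map
      (Prod.map (fun ω => (meanPower m (S.power ω)).toNNReal) id) := by
    rw [← Measure.map_prod_map _ _ hm measurable_id, Measure.map_id]
    rfl
  rw [ofReal_loss_eq, hmap, Measure.map_apply (hm.prodMap measurable_id)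
    (measurableSet_loss F.measurable_level)]
  refine measure_mono_ae ?_
  filter_upwards [Measure.quasiMeasurePreserving_fst.ae (ae_coe_frame_eq hS)] with z hz hlt
  change capacity m N (S.power z.1) (F.jam z.2) < ENNReal.ofReal R
  by_contra! hle
  have h1 := F.jam_secure z.2 _ (measurable_power_apply S z.1) hle
  rw [← hz] at h1
  have h2 : F.level z.2 ≤ (meanPower m (S.power z.1)).toNNReal := by exact_mod_cast h1
  exact absurd hlt (not_lt.2 h2)

omit [IsProbabilityMeasure m] in
lemma frameOutage_eq : frameOutage m N R μ ν = ENNReal.ofReal (loss F.level μ ν) := by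
  unfold frameOutage
  simp only [F.requiredTx_eq, ENNReal.coe_le_coe]
  have h1 : {z : ℝ≥0 × ℝ≥0 | F.level z.2 ≤ z.1} = {z | z.1 < F.level z.2}ᶜ := by
    ext z
    simp
  rw [ofReal_loss_eq, ← prob_compl_eq_one_sub, h1, compl_compl]
  rw [h1]
  exact (measurableSet_loss F.measurable_level).compl

omit [IsProbabilityMeasure m] in
lemma txCurve_eq : txCurve m N R = fun y => (F.level y.toNNReal : ℝ) := by
  funext y
  unfold txCurve
  rw [ENNReal.ofReal, F.requiredTx_eq, ENNReal.coe_toReal]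

omit [IsProbabilityMeasure m] in
lemma jxCurve_eq : jxCurve m N R = fun x => (F.spoil x.toNNReal : ℝ) := rfl

lemma exists_frameSetting (hN : 0 < N) (hR : 0 < R) (hpos : ∀ᵐ h ∂m, 0 < h) (ha : 0 < a)
    (hb : 0 < b) : ∃ v₀ v kp kj, CaseProcedure (txCurve m N R) a b v₀ v kp kj ∧
      FrameSetting F.level F.spoil a b v kp kj := by
  have hc := F.continuous_level
  obtain ⟨v₀, v, kp, kj, h1, h2⟩ := exists_parameters (g := fun y => (F.level y.toNNReal : ℝ))
    (a := a) (b := b) (by fun_prop)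
    (fun x hx y hy hxy => by
      have : x.toNNReal < y.toNNReal :=
        (Real.toNNReal_lt_toNNReal_iff (lt_of_le_of_lt hx hxy)).2 hxy
      exact_mod_cast F.strictMono_level this)
    (by
      simp only [Real.toNNReal_zero]
      exact_mod_cast F.level_zero_pos)
    (fun x => by
      obtain ⟨y, hy⟩ := F.exists_le_level x.toNNReal
      refine ⟨y, y.coe_nonneg, ?_⟩
      rw [Real.toNNReal_coe]
      exact Real.toNNReal_le_iff_le_coe.1 hy)
    (fun y w hy hyw => by
      have := F.mul_level_le (Real.toNNReal_le_toNNReal hyw)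
      rwa [Real.coe_toNNReal _ hy, Real.coe_toNNReal _ (hy.trans hyw)] at this) ha hb
  rw [F.txCurve_eq]
  exact ⟨v₀, v, kp, kj, h1, ⟨hc, F.strictMono_level, F.level_zero_pos,
    F.spoil_le_iff hN hR hpos, fun x hx => F.exists_level_eq hx, ha, hb, h2⟩⟩

end SaddleFamily

lemma cdfOn_eq {μ : Measure ℝ≥0} {x : ℝ} (hx : 0 ≤ x) : cdfOn μ x = μ.real (Iic x.toNNReal) := by
  unfold cdfOn
  congr 1
  ext t
  simp only [mem_ofPred_eq, mem_Iic]
  rw [Real.le_toNNReal_iff_coe_le hx]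

lemma uniformCDF_zero {t x : ℝ} (ht : 0 < t) (hx : 0 ≤ x) : uniformCDF 0 t x = min 1 (x / t) := by
  unfold uniformCDF
  rw [sub_zero, sub_zero, max_eq_right]
  exact le_min zero_le_one (div_nonneg hx ht.le)

lemma diracCDF_of_nonneg {x : ℝ} (hx : 0 ≤ x) : diracCDF x = 1 := if_pos hx

namespace FrameSetting

variable {g ginv : ℝ≥0 → ℝ≥0} {a b v kp kj : ℝ} (H : FrameSetting g ginv a b v kp kj)

include H

lemma isTxLaw : IsTxLaw (fun y => (g y.toNNReal : ℝ)) kp v (txLaw g kp v) := by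
  constructor
  · intro y hy
    rw [cdfOn_eq (NNReal.coe_nonneg _), Real.toNNReal_coe, txLaw_Iic H.par H.strictMono,
      Real.coe_toNNReal _ hy, uniformCDF_zero (by linarith [H.par.v_pos]) hy,
      diracCDF_of_nonneg hy, mul_one]
  · intro x hx hx0
    simp only [Real.toNNReal_zero] at hx0
    rw [cdfOn_eq hx]
    exact txLaw_Iic_of_lt H.par H.strictMono ((Real.toNNReal_lt_iff_lt_coe hx).2 hx0)

lemma isJxLaw : IsJxLaw (fun y => (g y.toNNReal : ℝ)) (fun x => (ginv x.toNNReal : ℝ)) kj v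
    (jamLaw ginv kj (g (2 * v).toNNReal)) := by
  intro x hx
  simp only [Real.toNNReal_zero] at hx
  have hx0 : 0 ≤ x := (NNReal.coe_nonneg _).trans hx
  obtain ⟨y, hy⟩ := H.surj x.toNNReal ((Real.le_toNNReal_iff_coe_le hx0).2 hx)
  have h1 : ginv x.toNNReal = y := by
    rw [← hy]
    refine le_antisymm ((H.inv_le_iff _ _).2 le_rfl) ?_
    exact H.strictMono.le_iff_le.1 ((H.inv_le_iff _ _).1 le_rfl)
  have h2 : (g y : ℝ) = x := by rw [hy, Real.coe_toNNReal _ hx0]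
  rw [cdfOn_eq (NNReal.coe_nonneg _), Real.toNNReal_coe, h1,
    jamLaw_Iic H.par H.inv_le_iff H.a_pos, h2, uniformCDF_zero H.top_pos hx0,
    diracCDF_of_nonneg hx0, mul_one]

lemma gameValue_nonneg : 0 ≤ gameValue b v kp :=
  measureReal_nonneg.trans (H.loss_txLaw_le H.jamLaw_mem')

lemma half_inv_le : (ginv a.toNNReal : ℝ) / 2 ≤ v := by
  have h1 : ginv a.toNNReal ≤ (2 * v).toNNReal :=
    (H.inv_le_iff _ _).2 (Real.toNNReal_le_iff_le_coe.2 H.par.a_lt.le)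
  have h2 : (ginv a.toNNReal : ℝ) ≤ ((2 * v).toNNReal : ℝ≥0) := by exact_mod_cast h1
  rw [H.coe_top] at h2
  linarith

end FrameSetting

namespace SaddleFamily

variable (F : SaddleFamily m N R) {a b v kp kj : ℝ}
  (H : FrameSetting F.level F.spoil a b v kp kj)

include H

omit [IsProbabilityMeasure m] in
theorem isNashEquilibrium_frame_iff (μ ν : Measure ℝ≥0) :
    IsNashEquilibrium (averageLaws a) (averageLaws b) (frameOutage m N R) μ ν ↔
      μ = txLaw F.level kp v ∧ ν = jamLaw F.spoil kj (F.level (2 * v).toNNReal) := by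
  have hP := txLaw_mem H.par H.cont H.strictMono
  have hJ := H.jamLaw_mem'
  have hprobP := hP.1
  have hprobJ := hJ.1
  have h1 : ∀ ν ∈ averageLaws b, frameOutage m N R (txLaw F.level kp v) ν
      ≤ ENNReal.ofReal (gameValue b v kp) := fun ν hν => by
    have := hν.1
    rw [F.frameOutage_eq]
    exact ENNReal.ofReal_le_ofReal (H.loss_txLaw_le hν)
  have h2 : ∀ μ ∈ averageLaws a, ENNReal.ofReal (gameValue b v kp)
      ≤ frameOutage m N R μ (jamLaw F.spoil kj (F.level (2 * v).toNNReal)) := fun μ hμ => by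
    have := hμ.1
    rw [F.frameOutage_eq]
    exact ENNReal.ofReal_le_ofReal (H.le_loss_jamLaw hμ)
  rw [isNashEquilibrium_iff hP hJ h1 h2]
  constructor
  · rintro ⟨hμ, hν, h3, h4⟩
    have := hμ.1
    have := hν.1
    refine ⟨H.eq_txLaw_of_optimal hμ fun ν' hν' => ?_, H.eq_jamLaw_of_optimal hν fun μ' hμ' => ?_⟩
    · have := hν'.1
      have h5 := h3 ν' hν'
      rw [F.frameOutage_eq] at h5
      exact (ENNReal.ofReal_le_ofReal_iff H.gameValue_nonneg).1 h5
    · have := hμ'.1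
      have h5 := h4 μ' hμ'
      rw [F.frameOutage_eq] at h5
      exact (ENNReal.ofReal_le_ofReal_iff measureReal_nonneg).1 h5
  · rintro ⟨rfl, rfl⟩
    exact ⟨hP, hJ, h1, h2⟩

theorem jamming_equilibria (hN : 0 < N) (hR : 0 < R) (hpos : ∀ᵐ h ∂m, 0 < h) :
    (∃ S T, IsNashEquilibrium (averagePower m a) (averagePower m b) (outage m N R) S T) ∧
    ∀ S T, IsNashEquilibrium (averagePower m a) (averagePower m b) (outage m N R) S T →
      frameLaw m S = txLaw F.level kp v ∧
      frameLaw m T = jamLaw F.spoil kj (F.level (2 * v).toNNReal) := by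
  have hP := txLaw_mem H.par H.cont H.strictMono
  have hJ := H.jamLaw_mem'
  have hprobP := hP.1
  have hprobJ := hJ.1
  have hspoil : Measurable F.spoil := (monotone_of_le_iff H.inv_le_iff).measurable
  have hS := F.txStrategy_mem hN hR hpos hspoil hP
  have hT := F.jamStrategy_mem hJ
  have h1 : ∀ T ∈ averagePower m b, outage m N R (F.txStrategy (txLaw F.level kp v) hspoil) T
      ≤ ENNReal.ofReal (gameValue b v kp) := fun T hT =>
    (F.outage_txStrategy_le hN hR hpos hspoil hT).trans
      (ENNReal.ofReal_le_ofReal (H.loss_txLaw_le (frameLaw_mem hT)))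
  have h2 : ∀ S ∈ averagePower m a, ENNReal.ofReal (gameValue b v kp)
      ≤ outage m N R S (F.jamStrategy (jamLaw F.spoil kj (F.level (2 * v).toNNReal))) :=
    fun S hS => (ENNReal.ofReal_le_ofReal (H.le_loss_jamLaw (frameLaw_mem hS))).trans
      (F.le_outage_jamStrategy hS)
  have hiff := isNashEquilibrium_iff hS hT h1 h2
  refine ⟨⟨_, _, (hiff _ _).2 ⟨hS, hT, h1, h2⟩⟩, fun S T hST => ?_⟩
  obtain ⟨hS', hT', h3, h4⟩ := (hiff S T).1 hST
  refine ⟨H.eq_txLaw_of_optimal (frameLaw_mem hS') fun ν hν => ?_,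
    H.eq_jamLaw_of_optimal (frameLaw_mem hT') fun μ hμ => ?_⟩
  · have := hν.1
    exact (ENNReal.ofReal_le_ofReal_iff H.gameValue_nonneg).1
      ((F.le_outage_jamStrategy hS').trans (h3 _ (F.jamStrategy_mem hν)))
  · have := hμ.1
    exact (ENNReal.ofReal_le_ofReal_iff measureReal_nonneg).1
      ((h4 _ (F.txStrategy_mem hN hR hpos hspoil hμ)).trans
        (F.outage_txStrategy_le hN hR hpos hspoil hT'))

end SaddleFamily

end FrameLaw

/-! ### The channel law -/

section ChannelLaw

variable {p : ℝ → ℝ}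

lemma isProbabilityMeasure_channelLaw
    (hp_one : ∫⁻ h in Ioi (0 : ℝ), ENNReal.ofReal (p h) = 1) :
    IsProbabilityMeasure (channelLaw p) := by
  constructor
  rw [channelLaw, withDensity_apply _ .univ, Measure.restrict_univ, hp_one]

lemma ae_pos_channelLaw : ∀ᵐ h ∂(channelLaw p), 0 < h :=
  (withDensity_absolutelyContinuous _ _).ae_le (ae_restrict_mem measurableSet_Ioi)

lemma integrable_log_channelLaw
    (hp_log : ∫⁻ h, ENNReal.ofReal (Real.log (1 + h)) ∂(channelLaw p) < ∞) :
    Integrable (fun h => Real.log (1 + h)) (channelLaw p) := by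
  refine (lintegral_ofReal_ne_top_iff_integrable
    (Measurable.aestronglyMeasurable (by fun_prop)) ?_).1 hp_log.ne
  filter_upwards [ae_pos_channelLaw] with h hh
  exact Real.log_nonneg (by linarith)

end ChannelLaw

end JammingGame

open JammingGame in
theorem mainTheorem2
    (p : ℝ → ℝ) (hp_meas : Measurable p) (hp_nonneg : ∀ h, 0 ≤ p h)
    (hp_one : ∫⁻ h in Ioi (0 : ℝ), ENNReal.ofReal (p h) = 1)
    (hp_log : ∫⁻ h, ENNReal.ofReal (Real.log (1 + h)) ∂(channelLaw p) < ∞)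
    (N R Pav Jav : ℝ) (hN : 0 < N) (hR : 0 < R) (hPav : 0 < Pav) (hJav : 0 < Jav) :
    (∀ j : ℝ≥0, requiredTx (channelLaw p) N R j < ∞) ∧
    (∀ q : ℝ≥0, requiredJx (channelLaw p) N R q < ∞) ∧
    ∃ v₀ v kp kj : ℝ,
      CaseProcedure (txCurve (channelLaw p) N R) Pav Jav v₀ v kp kj ∧
      max Jav (jxCurve (channelLaw p) N R Pav / 2) ≤ v ∧
      kp ∈ Icc (0 : ℝ) 1 ∧ kj ∈ Icc (0 : ℝ) 1 ∧
      ∃ FP FJ : Measure ℝ≥0,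
        IsTxLaw (txCurve (channelLaw p) N R) kp v FP ∧
        IsJxLaw (txCurve (channelLaw p) N R) (jxCurve (channelLaw p) N R) kj v FJ ∧
        (∀ μ ν : Measure ℝ≥0,
          IsNashEquilibrium (averageLaws Pav) (averageLaws Jav)
            (frameOutage (channelLaw p) N R) μ ν ↔ μ = FP ∧ ν = FJ) ∧
        (∃ S T : MixedAllocation,
          IsNashEquilibrium (averagePower (channelLaw p) Pav) (averagePower (channelLaw p) Jav)
            (outage (channelLaw p) N R) S T) ∧
        (∀ S T : MixedAllocation,
          IsNashEquilibrium (averagePower (channelLaw p) Pav) (averagePower (channelLaw p) Jav)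
            (outage (channelLaw p) N R) S T →
          frameLaw (channelLaw p) S = FP ∧ frameLaw (channelLaw p) T = FJ) := by
  have hprob := isProbabilityMeasure_channelLaw hp_one
  have hpos := ae_pos_channelLaw (p := p)
  obtain ⟨F⟩ := nonempty_saddleFamily hpos (integrable_log_channelLaw hp_log) hR hN
  obtain ⟨v₀, v, kp, kj, hcase, H⟩ := F.exists_frameSetting hN hR hpos hPav hJav
  obtain ⟨hex, hall⟩ := F.jamming_equilibria H hN hR hpos
  refine ⟨fun j => by rw [F.requiredTx_eq]; exact ENNReal.coe_lt_top,
    F.requiredJx_lt_top hN hR hpos, v₀, v, kp, kj, hcase, max_le H.par.b_le H.half_inv_le,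
    ⟨H.par.kp_pos.le, H.par.kp_le⟩, ⟨H.par.kj_pos.le, H.par.kj_le⟩, _, _, ?_, ?_,
    F.isNashEquilibrium_frame_iff H, hex, hall⟩
  · rw [F.txCurve_eq]
    exact H.isTxLaw
  · rw [F.txCurve_eq, F.jxCurve_eq]
    exact H.isJxLaw
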